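/- Let $\mathcal H$ be a separable real Hilbert space and let $\rho$ be a probability measure on $\mathcal H\times\mathbb R$ (the law of a pair $(X,Y)$), with marginal $\rho_{\mathcal H}$ on $\mathcal H$ and conditional measures $\rho(\cdot\,|x)$ on $\mathbb R$. Assume that there are $M,\kappa\in\,]0,+\infty[$ such that $|y|\le M$ $\rho$-almost surely and $\|x\|^2\le\kappa$ $\rho_{\mathcal H}$-almost surely. Put $\mathcal E(w)=\int(\langle w,x\rangle-y)^2\,d\rho(x,y)$ for $w\in\mathcal H$, let $\|\cdot\|_\rho$ be the norm of $L^2(\mathcal H,\rho_{\mathcal H})$, let $f_\rho(x)=\int y\,d\rho(y|x)$, and let $g_\rho$ be the minimizer of $\|f_\rho-h\|_\rho$ over all $h$ in the closure in $L^2(\mathcal H,\rho_{\mathcal H})$ of the set of linear functions $\langle w,\cdot\rangle$, $w\in\mathcal H$. Let $L$ be the (compact, positive, self-adjoint) operator on $L^2(\mathcal H,\rho_{\mathcal H})$ given by $Lf(x)=\int\langle x,x'\rangle f(x')\,d\rho_{\mathcal H}(x')$, and assume the source condition: $g_\rho=L^r g$ for some $r\in\,]1/2,+\infty[$ and some $g\in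 L^2(\mathcal H,\rho_{\mathcal H})$. Let $\gamma\in\,]0,\kappa^{-1}]$, let $n\ge1$, and let $(x_1,y_1),\dots,(x_n,y_n)$ be independent random pairs with law $\rho$. Define $\hat w_0=0$ and, for $t\ge0$, $\hat w_{t+1}=\hat u_t^n$, where $\hat u_t^0=\hat w_t$ and $\hat u_t^i=\hat u_t^{i-1}-\frac{\gamma}{n}\big(\langle\hat u_t^{i-1},x_i\rangle-y_i\big)x_i$ for $i=1,\dots,n$. Let $\delta\in\,]0,1[$. Then: (i) For every integer $t\ge1$, with probability greater than $1-\delta$, $$\mathcal E(\hat w_t)-\inf_{\mathcal H}\mathcal E\le\frac{2\,(32\log(16/\delta))^2}{n}\Big[M+2M^2\kappa^{-1/2}+3\kappa^r\|g\|_\rho\Big]^2t^2+2\Big(\frac{r}{\gamma t}\Big)^{2r}\|g\|_\rho^2 .$$ (ii) For $t^*(n)=\big\lceil n^{1/(2(1+r))}\big\rceil$, with probability greater than $1-\delta$, $$\mathcal E(\hat w_{t^*(n)})-\inf_{\mathcal H}\mathcal E\le\Big[8\,(32\log(16/\delta))^2\big(M+2M^2\kappa^{-1/2}+3\kappa^r\|g\|_\rho\big)^2+2\Big(\frac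 r\gamma\Big)^{2r}\|g\|_\rho^2\Big]\,n^{-r/(r+1)} .$$ -/

import Mathlib

open MeasureTheory ProbabilityTheory Filter Topology
open scoped RealInnerProductSpace ENNReal

namespace IncrementalLearning

section Operators

variable {E : Type*} [NormedAddCommGroup E] [InnerProductSpace ℝ E] [CompleteSpace E]

/-- The fractional power `A ^ r` of a compact positive self-adjoint operator `A` on a real Hilbert
space, given by the spectral theorem: `A ^ r g = ∑_μ μ ^ r P_μ g`, where `P_μ` is the orthogonal
projection onto the eigenspace `ker (A - μ)` (which is zero unless `μ` is an eigenvalue).  For such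
`A` and `0 ≤ r` the family is summable for every `g`, since its members are pairwise orthogonal and
`0 ≤ μ ≤ ‖A‖` for every eigenvalue `μ`. -/
noncomputable def fracPow (A : E →L[ℝ] E) (r : ℝ) (g : E) : E :=
  ∑' μ : ℝ, (μ ^ r) • ((A - μ • ContinuousLinearMap.id ℝ E).ker.starProjection g)

end Operators

variable {H : Type*} [NormedAddCommGroup H] [InnerProductSpace ℝ H] [CompleteSpace H]
  [TopologicalSpace.SeparableSpace H] [MeasurableSpace H] [BorelSpace H]

/-- Linear functions are square integrable when the inputs are almost surely bounded. -/
theorem memLp_inner (ν : Measure H) [IsFiniteMeasure ν] {κ : ℝ} (hκ : ∀ᵐ x ∂ν, ‖x‖ ^ 2 ≤ κ)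
    (w : H) : MemLp (fun x : H => ⟪x, w⟫) 2 ν := by
  refine MemLp.of_bound (C := √κ * ‖w‖) ?_ ?_
  · exact ((continuous_id.inner continuous_const).measurable).aestronglyMeasurable
  · filter_upwards [hκ] with x hx
    exact (norm_inner_le_norm x w).trans
      (mul_le_mul_of_nonneg_right (Real.le_sqrt_of_sq_le hx) (norm_nonneg _))

/-- The vector-valued integrand `f(x) x` is integrable for square integrable `f`. -/
theorem integrable_smul (ν : Measure H) [IsFiniteMeasure ν] {κ : ℝ}
    (hκ : ∀ᵐ x ∂ν, ‖x‖ ^ 2 ≤ κ) (f : Lp ℝ 2 ν) : Integrable (fun x : H => f x • x) ν := by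
  have : SecondCountableTopology H := UniformSpace.secondCountable_of_separable H
  have hf : Integrable (f : H → ℝ) ν := (Lp.memLp f).integrable (by norm_num)
  refine (hf.norm.mul_const (√κ)).mono' (hf.1.smul measurable_id.aestronglyMeasurable) ?_
  filter_upwards [hκ] with x hx
  rw [norm_smul]
  exact mul_le_mul_of_nonneg_left (Real.le_sqrt_of_sq_le hx) (norm_nonneg _)

theorem integral_inner_mul (ν : Measure H) [IsFiniteMeasure ν] {κ : ℝ}
    (hκ : ∀ᵐ x ∂ν, ‖x‖ ^ 2 ≤ κ) (f : Lp ℝ 2 ν) (x : H) :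
    ∫ x', ⟪x, x'⟫ * f x' ∂ν = ⟪x, ∫ x', f x' • x' ∂ν⟫ := by
  rw [← integral_inner (integrable_smul ν hκ f) x]
  refine integral_congr_ae (Eventually.of_forall fun x' => ?_)
  simp only [inner_smul_right]
  ring

theorem memLp_integral (ν : Measure H) [IsFiniteMeasure ν] {κ : ℝ}
    (hκ : ∀ᵐ x ∂ν, ‖x‖ ^ 2 ≤ κ) (f : Lp ℝ 2 ν) :
    MemLp (fun x : H => ∫ x', ⟪x, x'⟫ * f x' ∂ν) 2 ν := by
  simp only [integral_inner_mul ν hκ f]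
  exact memLp_inner ν hκ _

/-- The integral operator `L f (x) = ∫ ⟪x, x'⟫ f(x') dν(x')` on `L²(ν)`, as a linear map. -/
noncomputable def integralLin (ν : Measure H) [IsFiniteMeasure ν] {κ : ℝ}
    (hκ : ∀ᵐ x ∂ν, ‖x‖ ^ 2 ≤ κ) : Lp ℝ 2 ν →ₗ[ℝ] Lp ℝ 2 ν where
  toFun f := (memLp_integral ν hκ f).toLp
  map_add' f g := by
    rw [← MemLp.toLp_add]
    refine MemLp.toLp_congr _ _ (Eventually.of_forall fun x => ?_)
    simp only [Pi.add_apply, integral_inner_mul ν hκ, ← inner_add_right]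
    rw [← integral_add (integrable_smul ν hκ f) (integrable_smul ν hκ g)]
    congr 1
    refine integral_congr_ae ?_
    filter_upwards [Lp.coeFn_add f g] with y hy
    rw [hy, Pi.add_apply, add_smul]
  map_smul' c f := by
    rw [RingHom.id_apply, ← MemLp.toLp_const_smul]
    refine MemLp.toLp_congr _ _ (Eventually.of_forall fun x => ?_)
    simp only [Pi.smul_apply, integral_inner_mul ν hκ, smul_eq_mul]
    rw [← real_inner_smul_right, ← integral_smul]
    congr 1
    refine integral_congr_ae ?_
    filter_upwards [Lp.coeFn_smul c f] with y hy
    rw [hy, Pi.smul_apply, smul_eq_mul, mul_smul]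

theorem integralLin_bound (ν : Measure H) [IsProbabilityMeasure ν] {κ : ℝ}
    (hκ : ∀ᵐ x ∂ν, ‖x‖ ^ 2 ≤ κ) (f : Lp ℝ 2 ν) : ‖integralLin ν hκ f‖ ≤ κ * ‖f‖ := by
  have hκ0 : 0 ≤ κ := by
    obtain ⟨x, hx⟩ := hκ.exists
    exact (sq_nonneg _).trans hx
  have h1 : ‖∫ x', f x' • x' ∂ν‖ ≤ √κ * ‖f‖ := by
    have hf : Integrable (f : H → ℝ) ν := (Lp.memLp f).integrable (by norm_num)
    have ha : ‖∫ x', f x' • x' ∂ν‖ ≤ ∫ x', √κ * ‖f x'‖ ∂ν := by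
      refine norm_integral_le_of_norm_le (hf.norm.const_mul _) ?_
      filter_upwards [hκ] with x hx
      rw [norm_smul, mul_comm]
      exact mul_le_mul_of_nonneg_right (Real.le_sqrt_of_sq_le hx) (norm_nonneg _)
    rw [integral_const_mul] at ha
    refine ha.trans (mul_le_mul_of_nonneg_left ?_ (Real.sqrt_nonneg _))
    rw [integral_norm_eq_lintegral_enorm hf.1, ← eLpNorm_one_eq_lintegral_enorm, Lp.norm_def]
    exact ENNReal.toReal_mono (Lp.eLpNorm_ne_top f)
      (eLpNorm_le_eLpNorm_of_exponent_le (by norm_num) (Lp.aestronglyMeasurable f))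
  refine Lp.norm_le_of_ae_bound (p := 2) (μ := ν) (C := κ * ‖f‖) (by positivity) ?_ |>.trans ?_
  · filter_upwards [(memLp_integral ν hκ f).coeFn_toLp, hκ] with x hx hxk
    change ‖((memLp_integral ν hκ f).toLp : H → ℝ) x‖ ≤ _
    rw [hx, integral_inner_mul ν hκ f]
    calc _ ≤ ‖x‖ * ‖∫ x', f x' • x' ∂ν‖ := norm_inner_le_norm _ _
      _ ≤ √κ * (√κ * ‖f‖) := by
        gcongr
        exact Real.le_sqrt_of_sq_le hxk
      _ = κ * ‖f‖ := by rw [← mul_assoc, Real.mul_self_sqrt hκ0]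
  · simp [measureUnivNNReal]

/-- The integral operator `L f (x) = ∫ ⟪x, x'⟫ f(x') dν(x')` on `L²(ν)`, for inputs that are almost
surely bounded (`‖x‖² ≤ κ`); the operator does not depend on the bound `κ`. -/
noncomputable def integralOp (ν : Measure H) [IsProbabilityMeasure ν] {κ : ℝ}
    (hκ : ∀ᵐ x ∂ν, ‖x‖ ^ 2 ≤ κ) : Lp ℝ 2 ν →L[ℝ] Lp ℝ 2 ν :=
  (integralLin ν hκ).mkContinuous κ (integralLin_bound ν hκ)

/-- The (classes of) linear functions `⟪w, ·⟫`, `w ∈ H`, in `L²(ν)`. -/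
def linearFunctions (ν : Measure H) : Set (Lp ℝ 2 ν) :=
  {f | ∃ w : H, f =ᵐ[ν] fun x => ⟪w, x⟫}

/-- The regression function `f_ρ(x) = ∫ y dρ(y|x)`. -/
noncomputable def regressionFun (ρ : Measure (H × ℝ)) [IsProbabilityMeasure ρ] (x : H) : ℝ :=
  ∫ y, y ∂(ρ.condKernel x)

/-- `h` is the minimizer of `‖f_ρ - h‖_ρ` over the closure in `L²(H, ρ_H)` of the linear functions
(`ρ.fst` is the marginal `ρ_H` of `ρ` on `H`). -/
def IsBestApprox (ρ : Measure (H × ℝ)) [IsProbabilityMeasure ρ] (h : Lp ℝ 2 ρ.fst) : Prop :=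
  h ∈ closure (linearFunctions ρ.fst) ∧
    ∀ h' ∈ closure (linearFunctions ρ.fst),
      eLpNorm (fun x => regressionFun ρ x - h x) 2 ρ.fst ≤
        eLpNorm (fun x => regressionFun ρ x - h' x) 2 ρ.fst

/-- The risk `𝓔(w) = ∫ (⟪w, x⟫ - y)² dρ(x, y)`. -/
noncomputable def risk (ρ : Measure (H × ℝ)) (w : H) : ℝ :=
  ∫ p, (⟪w, p.1⟫ - p.2) ^ 2 ∂ρ

/-- One epoch of the incremental gradient iteration: start from `w` and perform successively, for
`i = 1, …, n`, the updates `u ↦ u - (γ / n) (⟪u, xᵢ⟫ - yᵢ) xᵢ`, where `z i = (xᵢ, yᵢ)`. -/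
noncomputable def epoch (γ : ℝ) {n : ℕ} (z : Fin n → H × ℝ) (w : H) : H :=
  Fin.foldl n (fun u i => u - (γ / n) • ((⟪u, (z i).1⟫ - (z i).2) • (z i).1)) w

/-- The iterate `ŵ_t`: the result of `t` epochs started from `w₀`. -/
noncomputable def iterates (γ : ℝ) {n : ℕ} (z : Fin n → H × ℝ) (w₀ : H) (t : ℕ) : H :=
  (epoch γ z)^[t] w₀

end IncrementalLearning

/-! With `S : H → L²(ρ_H)`, `S w = ⟪w, ·⟫`, one has `L = S S*`. Since `r > 1/2`, the source
condition puts `g_ρ` in the range of `S` itself (`exists_preimage_fracPow`): `g_ρ = S v`. This `v`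
annihilates the gradient of the risk (`riskGrad_eq_zero`), and as the risk is quadratic, the excess
risk at `u` is exactly `‖S (u - v)‖²` (`risk_eq`, `iInf_risk`).

Compare `ŵ_t` with `w_t`, obtained from `0` by `n t` deterministic gradient steps on the true risk
with step `η = γ / n`.

Approximation: `S (w_t - v) = -(1 - η L) ^ (n t) L ^ r g`, and on the spectrum `(1 - η μ) ^ (n t) μ
^ r ≤ (r / (γ t)) ^ r` (`norm_gradient_residual_fracPow_le`).

Deviation: a pass over the data is nonexpansive, so `‖ŵ_t - w_t‖` is at most the sum over `s < t` of
the one-pass errors started from the deterministic points `w_s` (`norm_iterate_gradPass_sub_le`).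
Such an error is a sum of centred noises, each transported by a contraction that depends only on
later samples. Integrating one sample at a time gives a Pinelis-type bound `E cosh (l ‖error‖) ≤
cosh (l c) ^ n` (`lintegral_cosh_gradPass_sub_le`). Markov's inequality is applied once, to the sum
of the `t` hyperbolic cosines, and Jensen's inequality returns to the sum of the errors. This
replaces a union bound, so the logarithm does not involve `t`. -/

set_option linter.unusedSectionVars false

namespace IncrementalLearning

/-! ### Hilbert space tools: `cosh` of a norm, and spectral multipliers of `S S*`. -/

section Hilbert

variable {E F : Type*} [NormedAddCommGroup E] [InnerProductSpace ℝ E] [CompleteSpace E]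
  [NormedAddCommGroup F] [InnerProductSpace ℝ F] [CompleteSpace F]

/-- The function `s ↦ cosh √s = ∑ s ^ k / (2 k)!` is convex on `[0, ∞)`. The argument of the root is
the convex combination of `(a + b)²` and `(a - b)²` with weights `(1 ± τ) / 2`, and the right side
is the same combination of `cosh (a ± b)`; the series are compared term by term. -/
theorem cosh_sqrt_le (a b τ : ℝ) (h1 : -1 ≤ τ) (h2 : τ ≤ 1) :
    Real.cosh √(a ^ 2 + b ^ 2 + 2 * τ * (a * b)) ≤
      Real.cosh a * Real.cosh b + τ * (Real.sinh a * Real.sinh b) := by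
  have hs : a ^ 2 + b ^ 2 + 2 * τ * (a * b)
      = (1 + τ) / 2 * (a + b) ^ 2 + (1 - τ) / 2 * (a - b) ^ 2 := by ring
  have h0 : 0 ≤ a ^ 2 + b ^ 2 + 2 * τ * (a * b) := by
    rw [hs]
    exact add_nonneg (mul_nonneg (by linarith) (sq_nonneg _))
      (mul_nonneg (by linarith) (sq_nonneg _))
  have hr : Real.cosh a * Real.cosh b + τ * (Real.sinh a * Real.sinh b)
      = (1 + τ) / 2 * Real.cosh (a + b) + (1 - τ) / 2 * Real.cosh (a - b) := by
    rw [Real.cosh_add, Real.cosh_sub]; ring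
  rw [hr]
  refine hasSum_le (fun k => ?_) (Real.hasSum_cosh _)
    (((Real.hasSum_cosh (a + b)).mul_left ((1 + τ) / 2)).add
      ((Real.hasSum_cosh (a - b)).mul_left ((1 - τ) / 2)))
  rw [pow_mul, Real.sq_sqrt h0, hs, pow_mul, pow_mul, ← mul_div_assoc, ← mul_div_assoc, ← add_div]
  gcongr
  simpa only [smul_eq_mul] using (convexOn_pow (𝕜 := ℝ) k).2 (Set.mem_Ici.2 (sq_nonneg (a + b)))
    (Set.mem_Ici.2 (sq_nonneg (a - b))) (show 0 ≤ (1 + τ) / 2 by linarith)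
    (show 0 ≤ (1 - τ) / 2 by linarith) (by ring)

/-- A bound on `cosh ‖x + d‖` that is affine in the increment `d`. -/
theorem cosh_norm_add_le (x d : E) (c : ℝ) (hd : ‖d‖ ≤ c) :
    Real.cosh ‖x + d‖ ≤ Real.cosh ‖x‖ * Real.cosh c
      + ⟪x, d⟫ * ((‖x‖ * c)⁻¹ * (Real.sinh ‖x‖ * Real.sinh c)) := by
  have hc : 0 ≤ c := (norm_nonneg _).trans hd
  have hp : 0 ≤ ‖x‖ * c := by positivity
  have hle : |⟪x, d⟫| ≤ ‖x‖ * c :=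
    (abs_real_inner_le_norm x d).trans (by gcongr)
  have hτ : |⟪x, d⟫ * (‖x‖ * c)⁻¹| ≤ 1 := by
    rw [abs_mul, abs_inv, abs_of_nonneg hp, ← div_eq_mul_inv]
    exact div_le_one_of_le₀ hle hp
  -- When `‖x‖ * c = 0` the inverse is `0`, and Cauchy–Schwarz makes the inner product vanish too.
  have hin : ⟪x, d⟫ * (‖x‖ * c)⁻¹ * (‖x‖ * c) = ⟪x, d⟫ := by
    rcases eq_or_ne (‖x‖ * c) 0 with h | h
    · rw [h] at hle
      rw [abs_nonpos_iff.1 hle]; simp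
    · rw [mul_assoc, inv_mul_cancel₀ h, mul_one]
  have h := cosh_sqrt_le ‖x‖ c _ (abs_le.1 hτ).1 (abs_le.1 hτ).2
  rw [mul_assoc 2, hin, mul_assoc] at h
  refine le_trans ?_ h
  rw [Real.cosh_le_cosh, abs_of_nonneg (norm_nonneg _), abs_of_nonneg (Real.sqrt_nonneg _)]
  refine Real.le_sqrt_of_sq_le ?_
  rw [norm_add_sq_real]
  have : ‖d‖ ^ 2 ≤ c ^ 2 := by gcongr
  linarith

theorem exists_hasSum_of_orthogonal {ι : Type*} (f : ι → E)
    (hf : Pairwise fun i j => ⟪f i, f j⟫ = 0) (b : ι → ℝ) (hb : ∀ i, ‖f i‖ ≤ b i) {B : ℝ}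
    (hB0 : 0 ≤ B) (hB : ∀ s : Finset ι, ∑ i ∈ s, b i ^ 2 ≤ B ^ 2) :
    ∃ v, HasSum f v ∧ ‖v‖ ≤ B := by
  have hV : OrthogonalFamily ℝ (fun i => ↥(Submodule.span ℝ {f i}))
      fun i => (Submodule.span ℝ {f i}).subtypeₗᵢ := by
    intro i j hij v w
    obtain ⟨v, hv⟩ := v
    obtain ⟨w, hw⟩ := w
    obtain ⟨a, rfl⟩ := Submodule.mem_span_singleton.1 hv
    obtain ⟨c, rfl⟩ := Submodule.mem_span_singleton.1 hw
    simp [inner_smul_left, inner_smul_right, hf hij]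
  let l : ∀ i, ↥(Submodule.span ℝ {f i}) := fun i => ⟨f i, Submodule.mem_span_singleton_self _⟩
  have hle : ∀ s : Finset ι, ∑ i ∈ s, ‖l i‖ ^ 2 ≤ B ^ 2 := fun s =>
    (Finset.sum_le_sum fun i _ => by
      have : ‖l i‖ = ‖f i‖ := rfl
      rw [this]; gcongr; exact hb i).trans (hB s)
  have hs : Summable f := (hV.summable_iff_norm_sq_summable l).2
    (summable_of_sum_le (fun i => sq_nonneg _) hle)
  refine ⟨_, hs.hasSum, ?_⟩
  refine le_of_tendsto hs.hasSum.norm (Eventually.of_forall fun s => ?_)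
  have h := (hV.norm_sum l s).trans_le (hle s)
  exact (abs_le_of_sq_le_sq' h hB0).2

theorem inner_eq_zero_of_eigen {A : F →L[ℝ] F} (hA : (A : F →ₗ[ℝ] F).IsSymmetric) {μ ν : ℝ}
    (h : μ ≠ ν) {u v : F} (hu : A u = μ • u) (hv : A v = ν • v) : ⟪u, v⟫ = 0 := by
  have h1 : ⟪A u, v⟫ = ⟪u, A v⟫ := hA u v
  rw [hu, hv, inner_smul_left, inner_smul_right] at h1
  have h2 : (μ - ν) * ⟪u, v⟫ = 0 := by
    rw [sub_mul]; simpa using sub_eq_zero.2 h1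
  exact (mul_eq_zero.1 h2).resolve_left (sub_ne_zero.2 h)

/-- The component of `g` in the eigenspace of `A` for `μ`. -/
noncomputable def eigenComponent (A : F →L[ℝ] F) (g : F) (μ : ℝ) : F :=
  (A - μ • ContinuousLinearMap.id ℝ F).ker.starProjection g

theorem apply_eigenComponent (A : F →L[ℝ] F) (g : F) (μ : ℝ) :
    A (eigenComponent A g μ) = μ • eigenComponent A g μ := by
  have h : eigenComponent A g μ ∈ (A - μ • ContinuousLinearMap.id ℝ F).ker :=
    Submodule.starProjection_apply_mem _ _
  rw [LinearMap.mem_ker] at h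
  simpa [sub_eq_zero] using h

theorem inner_eigenComponent_self (A : F →L[ℝ] F) (g : F) (μ : ℝ) :
    ⟪g, eigenComponent A g μ⟫ = ‖eigenComponent A g μ‖ ^ 2 := by
  have h := Submodule.starProjection_inner_eq_zero
    (K := (A - μ • ContinuousLinearMap.id ℝ F).ker) g (eigenComponent A g μ)
    (Submodule.starProjection_apply_mem _ _)
  rw [inner_sub_left, sub_eq_zero] at h
  rw [h]
  exact real_inner_self_eq_norm_sq _

/-- Bessel's inequality, from `‖g - p‖² ≥ 0` for the partial sum `p`. It is all that the multiplier
bounds need; completeness of the eigenvectors plays no role. -/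
theorem sum_norm_eigenComponent_sq_le {A : F →L[ℝ] F} (hA : (A : F →ₗ[ℝ] F).IsSymmetric) (g : F)
    (s : Finset ℝ) : ∑ μ ∈ s, ‖eigenComponent A g μ‖ ^ 2 ≤ ‖g‖ ^ 2 := by
  set p := ∑ μ ∈ s, eigenComponent A g μ
  have h1 : ⟪g, p⟫ = ∑ μ ∈ s, ‖eigenComponent A g μ‖ ^ 2 := by
    simp only [p, inner_sum, inner_eigenComponent_self]
  have h2 : ⟪p, p⟫ = ∑ μ ∈ s, ‖eigenComponent A g μ‖ ^ 2 := by
    simp only [p, inner_sum, sum_inner]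
    refine Finset.sum_congr rfl fun μ hμ => ?_
    rw [Finset.sum_eq_single μ, real_inner_self_eq_norm_sq]
    · intro ν _ hν
      exact inner_eq_zero_of_eigen hA hν (apply_eigenComponent A g ν) (apply_eigenComponent A g μ)
    · exact fun h => absurd hμ h
  have h3 : 0 ≤ ⟪g - p, g - p⟫ := real_inner_self_nonneg
  rw [real_inner_sub_sub_self, h1, h2, real_inner_self_eq_norm_sq] at h3
  linarith

/-- If `S S* v = μ v` then `‖S* v‖² = μ ‖v‖²`, which forces `μ ≥ 0` for `v ≠ 0`; the bound on `S` at
`S* v` then reads `μ² ‖v‖² ≤ κ μ ‖v‖²`. -/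
theorem eigenComponent_eq_zero_of_notMem {S : E →L[ℝ] F} {κ : ℝ} (hκ : 0 ≤ κ)
    (hS : ∀ w, ‖S w‖ ^ 2 ≤ κ * ‖w‖ ^ 2) (g : F) {μ : ℝ} (hμ : μ ∉ Set.Icc 0 κ) :
    eigenComponent (S ∘L S.adjoint) g μ = 0 := by
  set v := eigenComponent (S ∘L S.adjoint) g μ
  have hv : S (S.adjoint v) = μ • v := apply_eigenComponent (S ∘L S.adjoint) g μ
  have h1 : ‖S.adjoint v‖ ^ 2 = μ * ‖v‖ ^ 2 := by
    rw [← real_inner_self_eq_norm_sq, ContinuousLinearMap.adjoint_inner_left, hv,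
      inner_smul_right, real_inner_self_eq_norm_sq]
  by_contra hne
  have hpos : 0 < ‖v‖ ^ 2 := by positivity
  have hμ0 : 0 ≤ μ := by
    by_contra h
    nlinarith [sq_nonneg ‖S.adjoint v‖]
  refine hμ ⟨hμ0, ?_⟩
  have h2 := hS (S.adjoint v)
  rw [hv, norm_smul, mul_pow, h1, Real.norm_eq_abs, sq_abs] at h2
  rcases hμ0.eq_or_lt with h | h
  · rwa [← h]
  · exact le_of_mul_le_mul_right (by linarith : μ * (μ * ‖v‖ ^ 2) ≤ κ * (μ * ‖v‖ ^ 2))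
      (mul_pos h hpos)

theorem isSymmetric_comp_adjoint (S : E →L[ℝ] F) :
    ((S ∘L S.adjoint : F →L[ℝ] F) : F →ₗ[ℝ] F).IsSymmetric := by
  intro u v
  change ⟪S (S.adjoint u), v⟫ = ⟪u, S (S.adjoint v)⟫
  rw [← ContinuousLinearMap.adjoint_inner_right, ContinuousLinearMap.adjoint_inner_left]

/-- A spectral multiplier bounded by `C` on `[0, κ]` has norm at most `C`. -/
theorem exists_hasSum_eigenComponent {S : E →L[ℝ] F} {κ : ℝ} (hκ : 0 ≤ κ)
    (hS : ∀ w, ‖S w‖ ^ 2 ≤ κ * ‖w‖ ^ 2) (g : F) (a : ℝ → ℝ) {C : ℝ} (hC : 0 ≤ C)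
    (ha : ∀ μ ∈ Set.Icc 0 κ, |a μ| ≤ C) :
    ∃ v, HasSum (fun μ => a μ • eigenComponent (S ∘L S.adjoint) g μ) v ∧ ‖v‖ ≤ C * ‖g‖ := by
  have hA := isSymmetric_comp_adjoint S
  refine exists_hasSum_of_orthogonal _ (fun μ ν h => ?_)
    (fun μ => C * ‖eigenComponent (S ∘L S.adjoint) g μ‖) (fun μ => ?_) (by positivity) fun s => ?_
  · beta_reduce
    rw [inner_smul_left, inner_smul_right, inner_eq_zero_of_eigen hA h
      (apply_eigenComponent _ g μ) (apply_eigenComponent _ g ν)]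
    simp
  · by_cases h : μ ∈ Set.Icc 0 κ
    · rw [norm_smul]
      gcongr
      exact ha μ h
    · simp [eigenComponent_eq_zero_of_notMem hκ hS g h]
  · simp only [mul_pow, ← Finset.mul_sum]
    gcongr
    exact sum_norm_eigenComponent_sq_le hA g s

/-- Elements of the range of `(S S*) ^ r`, `r > 1/2`, lie in the range of `S`. -/
theorem exists_preimage_fracPow {S : E →L[ℝ] F} {κ : ℝ} (hκ : 0 ≤ κ)
    (hS : ∀ w, ‖S w‖ ^ 2 ≤ κ * ‖w‖ ^ 2) (g : F) {r : ℝ} (hr : 1 / 2 < r) :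
    ∃ w, S w = fracPow (S ∘L S.adjoint) r g ∧ ‖w‖ ≤ κ ^ (r - 1 / 2) * ‖g‖ := by
  set e := eigenComponent (S ∘L S.adjoint) g
  have hA := isSymmetric_comp_adjoint S
  have hin : ∀ μ ν, ⟪S.adjoint (e μ), S.adjoint (e ν)⟫ = ν * ⟪e μ, e ν⟫ := fun μ ν => by
    rw [ContinuousLinearMap.adjoint_inner_left, show S (S.adjoint (e ν)) = ν • e ν from
      apply_eigenComponent (S ∘L S.adjoint) g ν, inner_smul_right]
  -- Formally `w = S* (S S*) ^ (r - 1) g`. Its terms have squared norm `μ ^ (2 r - 1) ‖e μ‖²`, which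
  -- is where `r > 1/2` enters.
  obtain ⟨w, hw, hwn⟩ := exists_hasSum_of_orthogonal (fun μ => μ ^ (r - 1) • S.adjoint (e μ))
    (fun μ ν h => by
      beta_reduce
      rw [inner_smul_left, inner_smul_right, hin, inner_eq_zero_of_eigen hA h
        (apply_eigenComponent _ g μ) (apply_eigenComponent _ g ν)]
      simp)
    (fun μ => κ ^ (r - 1 / 2) * ‖e μ‖) (fun μ => by
      by_cases h : μ ∈ Set.Icc 0 κ
      · refine abs_le_of_sq_le_sq' ?_ (by positivity) |>.2
        rw [norm_smul, mul_pow, ← real_inner_self_eq_norm_sq (S.adjoint (e μ)), hin,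
          real_inner_self_eq_norm_sq, Real.norm_of_nonneg (Real.rpow_nonneg h.1 _), mul_pow,
          ← mul_assoc]
        gcongr
        rcases h.1.eq_or_lt with h0 | h0
        · rw [← h0]; simp; positivity
        · have h3 : (μ ^ (r - 1)) ^ 2 * μ = (μ ^ (r - 1 / 2)) ^ 2 := by
            rw [← Real.rpow_natCast, ← Real.rpow_natCast, ← Real.rpow_mul h0.le,
              ← Real.rpow_mul h0.le, ← Real.rpow_add_one h0.ne']
            congr 1; push_cast; ring
          rw [h3]
          have := Real.rpow_le_rpow h0.le h.2 (by linarith : 0 ≤ r - 1 / 2)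
          have h4 := Real.rpow_nonneg h0.le (r - 1 / 2)
          gcongr
      · simp [e, eigenComponent_eq_zero_of_notMem hκ hS g h])
    (B := κ ^ (r - 1 / 2) * ‖g‖) (by positivity) (fun s => by
      simp only [mul_pow, ← Finset.mul_sum]
      gcongr
      exact sum_norm_eigenComponent_sq_le hA g s)
  refine ⟨w, ?_, hwn⟩
  refine HasSum.unique (hw.mapL S) ?_
  have hterm : (fun μ => S (μ ^ (r - 1) • S.adjoint (e μ))) = fun μ => μ ^ r • e μ := by
    funext μ
    rw [map_smul, show S (S.adjoint (e μ)) = μ • e μ from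
      apply_eigenComponent (S ∘L S.adjoint) g μ, smul_smul]
    by_cases h : μ ∈ Set.Icc 0 κ
    · rcases h.1.eq_or_lt with h0 | h0
      · rw [← h0, Real.zero_rpow (show r ≠ 0 by linarith)]; simp
      · rw [← Real.rpow_add_one h0.ne']; simp
    · simp [e, eigenComponent_eq_zero_of_notMem hκ hS g h]
  rw [hterm]
  obtain ⟨v, hv, -⟩ := exists_hasSum_eigenComponent hκ hS g (fun μ => μ ^ r) (C := κ ^ r)
    (by positivity) (fun μ h => by
      rw [abs_of_nonneg (Real.rpow_nonneg h.1 _)]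
      exact Real.rpow_le_rpow h.1 h.2 (by linarith))
  exact hv.summable.hasSum

/-- The `r`-th power of `μ exp (-(s μ / r)) ≤ r / s`, which is `x ≤ exp x` at `x = s μ / r`. -/
theorem rpow_mul_exp_neg_le {r s μ : ℝ} (hr : 0 < r) (hs : 0 < s) (hμ : 0 ≤ μ) :
    μ ^ r * Real.exp (-(s * μ)) ≤ (r / s) ^ r := by
  have h1 : μ * Real.exp (-(s * μ / r)) ≤ r / s := by
    have h2 : s * μ / r ≤ Real.exp (s * μ / r) := by
      linarith [Real.add_one_le_exp (s * μ / r)]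
    rw [Real.exp_neg, ← div_eq_mul_inv, div_le_iff₀ (Real.exp_pos _)]
    calc μ = r / s * (s * μ / r) := by field_simp
      _ ≤ _ := by gcongr
  have h3 := Real.rpow_le_rpow (by positivity) h1 hr.le
  rw [Real.mul_rpow hμ (Real.exp_pos _).le, ← Real.exp_mul] at h3
  convert h3 using 3
  field_simp

/-- The qualification of gradient descent: `‖(1 - η A) ^ m A ^ r g‖ ≤ (r / (η m)) ^ r ‖g‖`. -/
theorem norm_gradient_residual_fracPow_le {S : E →L[ℝ] F} {κ : ℝ} (hκ : 0 ≤ κ)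
    (hS : ∀ w, ‖S w‖ ^ 2 ≤ κ * ‖w‖ ^ 2) (g : F) {r : ℝ} (hr : 0 < r) {η : ℝ} (hη : 0 < η)
    (hηκ : η * κ ≤ 1) {m : ℕ} (hm : 0 < m) :
    ‖((ContinuousLinearMap.id ℝ F - η • (S ∘L S.adjoint)) ^ m) (fracPow (S ∘L S.adjoint) r g)‖
      ≤ (r / (η * m)) ^ r * ‖g‖ := by
  set A := S ∘L S.adjoint
  obtain ⟨u, hu, -⟩ := exists_hasSum_eigenComponent hκ hS g (fun μ => μ ^ r) (C := κ ^ r)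
    (by positivity) (fun μ h => by
      rw [abs_of_nonneg (Real.rpow_nonneg h.1 _)]
      exact Real.rpow_le_rpow h.1 (h.2) (by linarith))
  have hf : fracPow A r g = u := hu.tsum_eq
  obtain ⟨v, hv, hvn⟩ := exists_hasSum_eigenComponent hκ hS g (fun μ => (1 - η * μ) ^ m * μ ^ r)
    (C := (r / (η * m)) ^ r) (by positivity) (fun μ h => by
      have h1 : 0 ≤ 1 - η * μ := by nlinarith [h.2]
      have h2 := Real.rpow_nonneg h.1 r
      rw [abs_of_nonneg (by positivity), mul_comm]
      have hm' : (0 : ℝ) < m := by exact_mod_cast hm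
      refine le_trans ?_ (rpow_mul_exp_neg_le hr (by positivity) h.1)
      gcongr
      calc (1 - η * μ) ^ m ≤ Real.exp (-(η * μ)) ^ m := by
            gcongr
            linarith [Real.add_one_le_exp (-(η * μ))]
        _ = _ := by rw [← Real.exp_nat_mul]; congr 1; ring)
  have hstep : ∀ (k : ℕ) μ, ((ContinuousLinearMap.id ℝ F - η • A) ^ k) (eigenComponent A g μ)
      = (1 - η * μ) ^ k • eigenComponent A g μ := by
    intro k μ
    induction k with
    | zero => simp
    | succ k ih =>
      rw [pow_succ, mul_apply_eq_comp]
      have : (ContinuousLinearMap.id ℝ F - η • A) (eigenComponent A g μ)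
          = (1 - η * μ) • eigenComponent A g μ := by
        simp [apply_eigenComponent, sub_smul, smul_smul]
      rw [this, map_smul, ih, smul_smul, pow_succ, mul_comm]
  have h := hu.mapL ((ContinuousLinearMap.id ℝ F - η • A) ^ m)
  have he : ((ContinuousLinearMap.id ℝ F - η • A) ^ m) u = v := by
    refine HasSum.unique h ?_
    convert hv using 2 with μ
    rw [map_smul]
    erw [hstep m μ]
    rw [smul_smul, mul_comm]
  rw [hf, he]
  exact hvn

end Hilbert

/-! ### The factorisation `L = S S*` through `H`. -/

section Evaluation

variable {H : Type*} [NormedAddCommGroup H] [InnerProductSpace ℝ H] [CompleteSpace H]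
  [TopologicalSpace.SeparableSpace H] [MeasurableSpace H] [BorelSpace H]

theorem norm_toLp_inner_le (ν : Measure H) [IsProbabilityMeasure ν] {κ : ℝ}
    (hκ : ∀ᵐ x ∂ν, ‖x‖ ^ 2 ≤ κ) (w : H) : ‖(memLp_inner ν hκ w).toLp‖ ≤ √κ * ‖w‖ := by
  refine (Lp.norm_le_of_ae_bound (p := 2) (μ := ν) (C := √κ * ‖w‖) (by positivity) ?_).trans ?_
  · filter_upwards [(memLp_inner ν hκ w).coeFn_toLp, hκ] with x hx hxk
    rw [hx]
    exact (norm_inner_le_norm x w).trans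
      (mul_le_mul_of_nonneg_right (Real.le_sqrt_of_sq_le hxk) (norm_nonneg _))
  · simp [measureUnivNNReal]

/-- The operator `H → L²(ν)` that maps `w` to the class of `⟪·, w⟫`. -/
noncomputable def evalOp (ν : Measure H) [IsProbabilityMeasure ν] {κ : ℝ}
    (hκ : ∀ᵐ x ∂ν, ‖x‖ ^ 2 ≤ κ) : H →L[ℝ] Lp ℝ 2 ν :=
  LinearMap.mkContinuous
    { toFun := fun w => (memLp_inner ν hκ w).toLp
      map_add' := fun v w => by
        rw [← MemLp.toLp_add]
        exact MemLp.toLp_congr _ _ (Eventually.of_forall fun x => inner_add_right x v w)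
      map_smul' := fun c w => by
        rw [RingHom.id_apply, ← MemLp.toLp_const_smul]
        exact MemLp.toLp_congr _ _ (Eventually.of_forall fun x => by simp [inner_smul_right]) }
    (√κ) (norm_toLp_inner_le ν hκ)

theorem coeFn_evalOp (ν : Measure H) [IsProbabilityMeasure ν] {κ : ℝ}
    (hκ : ∀ᵐ x ∂ν, ‖x‖ ^ 2 ≤ κ) (w : H) : evalOp ν hκ w =ᵐ[ν] fun x => ⟪x, w⟫ :=
  (memLp_inner ν hκ w).coeFn_toLp

theorem norm_evalOp_sq_le (ν : Measure H) [IsProbabilityMeasure ν] {κ : ℝ} (hκ0 : 0 ≤ κ)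
    (hκ : ∀ᵐ x ∂ν, ‖x‖ ^ 2 ≤ κ) (w : H) : ‖evalOp ν hκ w‖ ^ 2 ≤ κ * ‖w‖ ^ 2 := by
  have h : ‖evalOp ν hκ w‖ ≤ √κ * ‖w‖ := norm_toLp_inner_le ν hκ w
  calc _ ≤ (√κ * ‖w‖) ^ 2 := by gcongr
    _ = _ := by rw [mul_pow, Real.sq_sqrt hκ0]

theorem adjoint_evalOp (ν : Measure H) [IsProbabilityMeasure ν] {κ : ℝ}
    (hκ : ∀ᵐ x ∂ν, ‖x‖ ^ 2 ≤ κ) (f : Lp ℝ 2 ν) :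
    (evalOp ν hκ).adjoint f = ∫ x, f x • x ∂ν := by
  refine ext_inner_left ℝ fun w => ?_
  rw [ContinuousLinearMap.adjoint_inner_right, ← integral_inner_mul ν hκ, L2.inner_def]
  refine integral_congr_ae ?_
  filter_upwards [coeFn_evalOp ν hκ w] with x hx
  rw [hx, real_inner_comm]
  simp [real_inner_comm]

theorem integralOp_eq (ν : Measure H) [IsProbabilityMeasure ν] {κ : ℝ}
    (hκ : ∀ᵐ x ∂ν, ‖x‖ ^ 2 ≤ κ) : integralOp ν hκ = evalOp ν hκ ∘L (evalOp ν hκ).adjoint := by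
  ext1 f
  rw [ContinuousLinearMap.comp_apply, adjoint_evalOp]
  exact MemLp.toLp_congr (memLp_integral ν hκ f) (memLp_inner ν hκ _)
    (Eventually.of_forall fun x => integral_inner_mul ν hκ f x)

end Evaluation

/-! ### The risk as a quadratic function, and its minimizers. -/

section Risk

variable {H : Type*} [NormedAddCommGroup H] [InnerProductSpace ℝ H] [CompleteSpace H]
  [TopologicalSpace.SeparableSpace H] [MeasurableSpace H] [BorelSpace H]
  (ρ : Measure (H × ℝ)) [IsProbabilityMeasure ρ] {M κ : ℝ}

theorem ae_fst (hx : ∀ᵐ x ∂ρ.fst, ‖x‖ ^ 2 ≤ κ) : ∀ᵐ p ∂ρ, ‖p.1‖ ^ 2 ≤ κ :=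
  ae_of_ae_map measurable_fst.aemeasurable hx

/-- Half the gradient of the risk. -/
noncomputable def riskGrad (w : H) : H := ∫ p, (⟪w, p.1⟫ - p.2) • p.1 ∂ρ

theorem abs_residual_le {x w : H} {y : ℝ} (hx : ‖x‖ ^ 2 ≤ κ) (hy : |y| ≤ M) :
    |⟪w, x⟫ - y| ≤ √κ * ‖w‖ + M := by
  have h1 : |⟪w, x⟫| ≤ √κ * ‖w‖ := by
    refine (abs_real_inner_le_norm w x).trans ?_
    rw [mul_comm]
    gcongr
    exact Real.le_sqrt_of_sq_le hx
  exact (abs_sub _ _).trans (add_le_add h1 hy)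

theorem norm_residual_smul_le {x w : H} {y : ℝ} (hx : ‖x‖ ^ 2 ≤ κ) (hy : |y| ≤ M) :
    ‖(⟪w, x⟫ - y) • x‖ ≤ (√κ * ‖w‖ + M) * √κ := by
  rw [norm_smul]
  exact mul_le_mul (abs_residual_le hx hy) (Real.le_sqrt_of_sq_le hx) (norm_nonneg _)
    ((abs_nonneg _).trans (abs_residual_le (w := w) hx hy))

theorem measurable_residual (w : H) : Measurable fun p : H × ℝ => ⟪w, p.1⟫ - p.2 :=
  (((continuous_const.inner continuous_id).measurable).comp measurable_fst).sub measurable_snd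

theorem integrable_residual_smul (hy : ∀ᵐ p ∂ρ, |p.2| ≤ M) (hx : ∀ᵐ x ∂ρ.fst, ‖x‖ ^ 2 ≤ κ)
    (w : H) :
    Integrable (fun p : H × ℝ => (⟪w, p.1⟫ - p.2) • p.1) ρ := by
  have : SecondCountableTopology H := UniformSpace.secondCountable_of_separable H
  refine Integrable.of_bound
    ((measurable_residual w).smul measurable_fst).aestronglyMeasurable ((√κ * ‖w‖ + M) * √κ) ?_
  filter_upwards [hy, ae_fst ρ hx] with p h1 h2
  exact norm_residual_smul_le h2 h1

theorem inner_evalOp (hx : ∀ᵐ x ∂ρ.fst, ‖x‖ ^ 2 ≤ κ) (u v : H) :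
    ⟪evalOp ρ.fst hx u, evalOp ρ.fst hx v⟫ = ∫ p, ⟪u, p.1⟫ * ⟪v, p.1⟫ ∂ρ := by
  have h : ⟪evalOp ρ.fst hx u, evalOp ρ.fst hx v⟫ = ∫ x, ⟪u, x⟫ * ⟪v, x⟫ ∂ρ.fst := by
    rw [L2.inner_def]
    refine integral_congr_ae ?_
    filter_upwards [coeFn_evalOp ρ.fst hx u, coeFn_evalOp ρ.fst hx v] with x hu hv
    rw [hu, hv, real_inner_comm x u, real_inner_comm x v]
    simp [mul_comm]
  rw [h, Measure.fst, integral_map measurable_fst.aemeasurable]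
  exact ((continuous_const.inner continuous_id).mul
    (continuous_const.inner continuous_id)).measurable.aestronglyMeasurable

theorem riskGrad_sub (hy : ∀ᵐ p ∂ρ, |p.2| ≤ M) (hx : ∀ᵐ x ∂ρ.fst, ‖x‖ ^ 2 ≤ κ) (w v : H) :
    riskGrad ρ w - riskGrad ρ v
      = (evalOp ρ.fst hx).adjoint (evalOp ρ.fst hx (w - v)) := by
  have hw := integrable_residual_smul ρ hy hx w
  have hv := integrable_residual_smul ρ hy hx v
  have he : ∀ p : H × ℝ, (⟪w, p.1⟫ - p.2) • p.1 - (⟪v, p.1⟫ - p.2) • p.1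
      = ⟪w - v, p.1⟫ • p.1 := fun p => by
    rw [← sub_smul, inner_sub_left]; congr 1; ring
  refine ext_inner_left ℝ fun u => ?_
  rw [ContinuousLinearMap.adjoint_inner_right, inner_evalOp, riskGrad, riskGrad,
    ← integral_sub hw hv]
  refine (integral_inner (hw.sub hv) u).symm.trans ?_
  refine integral_congr_ae (Eventually.of_forall fun p => ?_)
  simp only [Pi.sub_apply, he, inner_smul_right, mul_comm]

/-- The exact second-order expansion at `v`. At a critical point the linear term drops out and the
excess risk is the squared `L²` distance. -/
theorem risk_eq (hy : ∀ᵐ p ∂ρ, |p.2| ≤ M) (hx : ∀ᵐ x ∂ρ.fst, ‖x‖ ^ 2 ≤ κ) (w v : H) :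
    risk ρ w = risk ρ v + 2 * ⟪w - v, riskGrad ρ v⟫ + ‖evalOp ρ.fst hx (w - v)‖ ^ 2 := by
  have hv := integrable_residual_smul ρ hy hx v
  have h1 : Integrable (fun p : H × ℝ => ⟪w - v, p.1⟫ * ⟪w - v, p.1⟫) ρ := by
    have hm : Measurable fun p : H × ℝ => ⟪w - v, p.1⟫ :=
      ((continuous_const.inner continuous_id).measurable).comp measurable_fst
    refine Integrable.of_bound (hm.mul hm).aestronglyMeasurable
      ((√κ * ‖w - v‖ + 0) * (√κ * ‖w - v‖ + 0)) ?_
    filter_upwards [ae_fst ρ hx] with p h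
    have := abs_residual_le (w := w - v) (y := 0) (M := 0) h (by simp)
    rw [sub_zero] at this
    rw [norm_mul, Real.norm_eq_abs]
    gcongr
  have h2 : Integrable (fun p : H × ℝ => (⟪v, p.1⟫ - p.2) ^ 2) ρ := by
    refine Integrable.of_bound ((measurable_residual v).pow_const 2).aestronglyMeasurable
      ((√κ * ‖v‖ + M) ^ 2) ?_
    filter_upwards [hy, ae_fst ρ hx] with p h h'
    rw [norm_pow, Real.norm_eq_abs]
    gcongr
    exact abs_residual_le h' h
  have h3 := (hv.const_inner (𝕜 := ℝ) (w - v)).const_mul 2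
  rw [← real_inner_self_eq_norm_sq, inner_evalOp, riskGrad, ← integral_inner hv, risk, risk,
    ← integral_const_mul, ← integral_add h2 h3]
  refine Eq.trans ?_ (integral_add (h2.add h3) h1)
  refine integral_congr_ae (Eventually.of_forall fun p => ?_)
  simp only [inner_smul_right, inner_sub_left]
  ring

theorem measurable_regressionFun : Measurable (regressionFun ρ) :=
  (measurable_snd.stronglyMeasurable (f := fun p : ℝ × ℝ => p.2) |>.comp_measurable
    (measurable_id.prodMk measurable_id)).integral_kernel.measurable

theorem ae_abs_regressionFun_le (hy : ∀ᵐ p ∂ρ, |p.2| ≤ M) :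
    ∀ᵐ x ∂ρ.fst, |regressionFun ρ x| ≤ M := by
  rw [← ρ.disintegrate ρ.condKernel] at hy
  filter_upwards [Measure.ae_ae_of_ae_compProd hy] with x hx
  refine (norm_integral_le_of_norm_le_const (f := fun y : ℝ => y) (C := M) hx).trans ?_
  simp

theorem integral_regressionFun_mul (hy : ∀ᵐ p ∂ρ, |p.2| ≤ M)
    (hx : ∀ᵐ x ∂ρ.fst, ‖x‖ ^ 2 ≤ κ) (w : H) :
    ∫ x, ⟪w, x⟫ * regressionFun ρ x ∂ρ.fst = ∫ p, ⟪w, p.1⟫ * p.2 ∂ρ := by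
  have hi : Integrable (fun p : H × ℝ => ⟪w, p.1⟫ * p.2) ρ := by
    have h := ((integrable_residual_smul ρ hy hx 0).const_inner (𝕜 := ℝ) w).neg
    refine h.congr (Eventually.of_forall fun p => ?_)
    simp [inner_smul_right, mul_comm]
  rw [← Measure.integral_condKernel hi]
  exact integral_congr_ae (Eventually.of_forall fun x => (integral_const_mul _ _).symm)

/-- A preimage in `H` of the best approximation is a critical point of the risk. -/
theorem riskGrad_eq_zero (hy : ∀ᵐ p ∂ρ, |p.2| ≤ M)
    (hx : ∀ᵐ x ∂ρ.fst, ‖x‖ ^ 2 ≤ κ) {gρ : Lp ℝ 2 ρ.fst} (hgρ : IsBestApprox ρ gρ) {v : H}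
    (hv : evalOp ρ.fst hx v = gρ) : riskGrad ρ v = 0 := by
  set S := evalOp ρ.fst hx
  have hF : MemLp (regressionFun ρ) 2 ρ.fst :=
    MemLp.of_bound (measurable_regressionFun ρ).aestronglyMeasurable M
      (ae_abs_regressionFun_le ρ hy)
  have hmem : ∀ w, S w ∈ linearFunctions ρ.fst := fun w => ⟨w, by
    filter_upwards [coeFn_evalOp ρ.fst hx w] with x h
    rw [h, real_inner_comm]⟩
  have hnorm : ∀ h : Lp ℝ 2 ρ.fst,
      eLpNorm (fun x => regressionFun ρ x - h x) 2 ρ.fst = ‖hF.toLp - h‖ₑ := fun h => by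
    rw [Lp.enorm_def]
    refine eLpNorm_congr_ae ?_
    filter_upwards [hF.coeFn_toLp, Lp.coeFn_sub hF.toLp h] with x h1 h2
    rw [h2, Pi.sub_apply, h1]
  have hle : ∀ w, ‖hF.toLp - S v‖ ≤ ‖hF.toLp - S w‖ := fun w => by
    have h := hgρ.2 _ (subset_closure (hmem w))
    rw [hnorm, hnorm, ← hv] at h
    exact enorm_le_iff_norm_le.1 h
  -- The best approximation `S v` lies in the range of `S`, so minimality within the range, rather
  -- than its closure, already gives orthogonality of the residual.
  have horth : ∀ w, ⟪hF.toLp - S v, S w⟫ = 0 := fun w => by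
    refine (Submodule.norm_eq_iInf_iff_real_inner_eq_zero S.range
      (v := S v) ⟨v, rfl⟩).1 ?_ _ ⟨w, rfl⟩
    refine le_antisymm (le_ciInf ?_) (ciInf_le ⟨0, ?_⟩ (⟨S v, v, rfl⟩ : S.range))
    · rintro ⟨_, w, rfl⟩
      exact hle w
    · rintro _ ⟨w, rfl⟩
      exact norm_nonneg _
  refine ext_inner_left ℝ fun w => ?_
  rw [inner_zero_right]
  have h1 : ⟪hF.toLp, S w⟫ = ∫ p, ⟪w, p.1⟫ * p.2 ∂ρ := by
    rw [← integral_regressionFun_mul ρ hy hx, L2.inner_def]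
    refine integral_congr_ae ?_
    filter_upwards [hF.coeFn_toLp, coeFn_evalOp ρ.fst hx w] with x h1 h2
    rw [h1, h2, real_inner_comm x w]
    simp
  have h2 : ⟪w, riskGrad ρ v⟫ = ⟪S v, S w⟫ - ∫ p, ⟪w, p.1⟫ * p.2 ∂ρ := by
    have h3 := riskGrad_sub ρ hy hx v 0
    have h4 : ⟪w, riskGrad ρ 0⟫ = - ∫ p, ⟪w, p.1⟫ * p.2 ∂ρ := by
      rw [riskGrad, ← integral_inner (integrable_residual_smul ρ hy hx 0), ← integral_neg]
      refine integral_congr_ae (Eventually.of_forall fun p => ?_)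
      simp [inner_smul_right, mul_comm]
    rw [sub_eq_iff_eq_add.1 h3, inner_add_right, h4, sub_zero,
      ContinuousLinearMap.adjoint_inner_right, real_inner_comm]
    rfl
  rw [h2, ← h1, ← inner_sub_left, ← neg_sub, inner_neg_left, horth, neg_zero]

theorem iInf_risk (hy : ∀ᵐ p ∂ρ, |p.2| ≤ M) (hx : ∀ᵐ x ∂ρ.fst, ‖x‖ ^ 2 ≤ κ) {v : H}
    (hv : riskGrad ρ v = 0) : ⨅ w, risk ρ w = risk ρ v := by
  refine le_antisymm (ciInf_le ⟨risk ρ v, ?_⟩ v) (le_ciInf fun w => ?_)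
  · rintro _ ⟨w, rfl⟩
    beta_reduce
    rw [risk_eq ρ hy hx w v, hv, inner_zero_right]
    nlinarith [sq_nonneg ‖evalOp ρ.fst hx (w - v)‖]
  · rw [risk_eq ρ hy hx w v, hv, inner_zero_right]
    nlinarith [sq_nonneg ‖evalOp ρ.fst hx (w - v)‖]

end Risk

/-! ### Exponential moments of the error of one pass. -/

section Deviation

variable {H : Type*} [NormedAddCommGroup H] [InnerProductSpace ℝ H] [CompleteSpace H]

/-- The bound of `cosh_norm_add_le` is affine in the increment, so a centred increment contributes
only the factor `cosh c`. -/
theorem lintegral_cosh_norm_add_le {α : Type*} [MeasurableSpace α] (μ : Measure α)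
    [IsProbabilityMeasure μ] {d : α → H} (hd : Integrable d μ) (h0 : ∫ a, d a ∂μ = 0) {c : ℝ}
    (hc : ∀ᵐ a ∂μ, ‖d a‖ ≤ c) (x : H) :
    ∫⁻ a, ENNReal.ofReal (Real.cosh ‖x + d a‖) ∂μ
      ≤ ENNReal.ofReal (Real.cosh ‖x‖ * Real.cosh c) := by
  set K := (‖x‖ * c)⁻¹ * (Real.sinh ‖x‖ * Real.sinh c)
  have hle : ∀ᵐ a ∂μ, Real.cosh ‖x + d a‖ ≤ Real.cosh ‖x‖ * Real.cosh c + ⟪x, d a⟫ * K := by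
    filter_upwards [hc] with a ha using cosh_norm_add_le x (d a) c ha
  have hi : Integrable (fun a => ⟪x, d a⟫ * K) μ := (hd.const_inner x).mul_const K
  calc ∫⁻ a, ENNReal.ofReal (Real.cosh ‖x + d a‖) ∂μ
      ≤ ∫⁻ a, ENNReal.ofReal (Real.cosh ‖x‖ * Real.cosh c + ⟪x, d a⟫ * K) ∂μ := by
        refine lintegral_mono_ae ?_
        filter_upwards [hle] with a ha using ENNReal.ofReal_le_ofReal ha
    _ = ENNReal.ofReal (∫ a, Real.cosh ‖x‖ * Real.cosh c + ⟪x, d a⟫ * K ∂μ) := by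
        refine (ofReal_integral_eq_lintegral_ofReal ((integrable_const _).add hi) ?_).symm
        filter_upwards [hle] with a ha using (Real.cosh_pos _).le.trans ha
    _ = _ := by
        rw [integral_add (integrable_const _) hi, integral_mul_const _ (fun a => ⟪x, d a⟫),
          integral_inner hd, h0]
        simp

/-- One update of the incremental iteration with step size `η`. -/
def gradStep (η : ℝ) (u : H) (p : H × ℝ) : H := u - η • ((⟪u, p.1⟫ - p.2) • p.1)

/-- The incremental iteration along the sample `z`, with step size `η`. -/
def gradPass (η : ℝ) {m : ℕ} (z : Fin m → H × ℝ) (u : H) : H :=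
  Fin.foldl m (fun u i => gradStep η u (z i)) u

theorem gradPass_succ (η : ℝ) {m : ℕ} (z : Fin (m + 1) → H × ℝ) (u : H) :
    gradPass η z u = gradPass η (fun i => z i.succ) (gradStep η u (z 0)) :=
  Fin.foldl_succ _ _

theorem gradStep_sub (η : ℝ) (u v : H) (p : H × ℝ) :
    gradStep η u p - gradStep η v p = (u - v) - (η * ⟪u - v, p.1⟫) • p.1 := by
  simp only [gradStep, inner_sub_left, smul_smul]
  module

theorem norm_sub_smul_inner_le {η κ : ℝ} (hη : 0 ≤ η) (hηκ : η * κ ≤ 1) {x : H}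
    (hx : ‖x‖ ^ 2 ≤ κ) (v : H) : ‖v - (η * ⟪v, x⟫) • x‖ ≤ ‖v‖ := by
  refine (abs_le_of_sq_le_sq' ?_ (norm_nonneg _)).2
  rw [norm_sub_sq_real, inner_smul_right, norm_smul, mul_pow, Real.norm_eq_abs, sq_abs, mul_pow]
  have h1 : η * ‖x‖ ^ 2 ≤ 1 := (mul_le_mul_of_nonneg_left hx hη).trans hηκ
  have h2 : 0 ≤ η * ⟪v, x⟫ ^ 2 := by positivity
  nlinarith [mul_le_mul_of_nonneg_left h1 h2]

theorem norm_gradStep_sub_le {η κ : ℝ} (hη : 0 ≤ η) (hηκ : η * κ ≤ 1) {p : H × ℝ}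
    (hp : ‖p.1‖ ^ 2 ≤ κ) (u v : H) : ‖gradStep η u p - gradStep η v p‖ ≤ ‖u - v‖ := by
  rw [gradStep_sub]
  exact norm_sub_smul_inner_le hη hηκ hp _

/-- Each update is affine in the iterate with linear part `1 - η x ⊗ x`, a contraction because `η
‖x‖² ≤ 1`; `Q` is the product of these. Linearity of `Q`, not just the Lipschitz bound, is needed to
keep transported noise centred. -/
theorem exists_gradPass_sub_eq {η κ : ℝ} (hη : 0 ≤ η) (hηκ : η * κ ≤ 1) {m : ℕ}
    (z : Fin m → H × ℝ) (hz : ∀ i, ‖(z i).1‖ ^ 2 ≤ κ) :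
    ∃ Q : H →L[ℝ] H, (∀ v, ‖Q v‖ ≤ ‖v‖) ∧
      ∀ u v, gradPass η z u - gradPass η z v = Q (u - v) := by
  induction m with
  | zero => exact ⟨ContinuousLinearMap.id ℝ H, fun v => le_rfl, fun u v => by simp [gradPass]⟩
  | succ m ih =>
    obtain ⟨Q, hQ, hQz⟩ := ih (fun i => z i.succ) fun i => hz _
    have hR : ∀ v, (ContinuousLinearMap.id ℝ H - η • (innerSL ℝ (z 0).1).smulRight (z 0).1) v
        = v - (η * ⟪v, (z 0).1⟫) • (z 0).1 := fun v => by
      simp [smul_smul, real_inner_comm]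
    refine ⟨Q ∘L (ContinuousLinearMap.id ℝ H - η • (innerSL ℝ (z 0).1).smulRight (z 0).1),
      fun v => ?_, fun u v => ?_⟩
    · rw [ContinuousLinearMap.comp_apply, hR]
      exact (hQ _).trans (norm_sub_smul_inner_le hη hηκ (hz 0) v)
    · rw [gradPass_succ, gradPass_succ, hQz, gradStep_sub, ContinuousLinearMap.comp_apply, hR]

theorem norm_gradPass_sub_le {η κ : ℝ} (hη : 0 ≤ η) (hηκ : η * κ ≤ 1) {m : ℕ}
    (z : Fin m → H × ℝ) (hz : ∀ i, ‖(z i).1‖ ^ 2 ≤ κ) (u v : H) :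
    ‖gradPass η z u - gradPass η z v‖ ≤ ‖u - v‖ := by
  obtain ⟨Q, hQ, h⟩ := exists_gradPass_sub_eq hη hηκ z hz
  rw [h]
  exact hQ _

/-- Telescoping: each pass carries the earlier error without enlarging it and adds the error of a
single pass started on the reference orbit of `G`. That orbit may be deterministic, which avoids the
dependence between iterates and reused samples. -/
theorem norm_iterate_gradPass_sub_le {η κ : ℝ} (hη : 0 ≤ η) (hηκ : η * κ ≤ 1) {m : ℕ}
    (z : Fin m → H × ℝ) (hz : ∀ i, ‖(z i).1‖ ^ 2 ≤ κ) (G : H → H) (u : H) (t : ℕ) :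
    ‖(gradPass η z)^[t] u - G^[t] u‖
      ≤ ∑ s ∈ Finset.range t, ‖gradPass η z (G^[s] u) - G (G^[s] u)‖ := by
  induction t with
  | zero => simp
  | succ t ih =>
    rw [Finset.sum_range_succ, Function.iterate_succ_apply', Function.iterate_succ_apply']
    refine (norm_sub_le_norm_sub_add_norm_sub _ (gradPass η z (G^[t] u)) _).trans ?_
    gcongr
    exact (norm_gradPass_sub_le hη hηκ z hz _ _).trans ih

variable [TopologicalSpace.SeparableSpace H] [MeasurableSpace H] [BorelSpace H]

theorem measurable_gradStep (η : ℝ) : Measurable fun q : H × (H × ℝ) => gradStep η q.1 q.2 := by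
  have : SecondCountableTopology H := UniformSpace.secondCountable_of_separable H
  unfold gradStep
  have : Continuous fun q : H × (H × ℝ) => q.1 - η • ((⟪q.1, q.2.1⟫ - q.2.2) • q.2.1) := by
    fun_prop
  exact this.measurable

theorem measurable_gradPass (η : ℝ) (m : ℕ) :
    Measurable fun q : (Fin m → H × ℝ) × H => gradPass η q.1 q.2 := by
  induction m with
  | zero => simpa [gradPass] using measurable_snd
  | succ m ih =>
    simp only [gradPass_succ]
    have h1 : Measurable fun q : (Fin (m + 1) → H × ℝ) × H => fun i : Fin m => q.1 i.succ :=
      measurable_pi_iff.2 fun i => (measurable_pi_apply i.succ).comp measurable_fst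
    have h2 : Measurable fun q : (Fin (m + 1) → H × ℝ) × H => q.1 0 :=
      (measurable_pi_apply 0).comp measurable_fst
    have h3 : Measurable fun q : (Fin (m + 1) → H × ℝ) × H => gradStep η q.2 (q.1 0) :=
      (measurable_gradStep η).comp (measurable_snd.prodMk h2)
    exact ih.comp (h1.prodMk h3)

variable (ρ : Measure (H × ℝ)) [IsProbabilityMeasure ρ] {M κ : ℝ}

/-- The gradient step for the risk. -/
noncomputable def riskStep (η : ℝ) (u : H) : H := u - η • riskGrad ρ u

theorem integrable_gradStep (hy : ∀ᵐ p ∂ρ, |p.2| ≤ M) (hx : ∀ᵐ x ∂ρ.fst, ‖x‖ ^ 2 ≤ κ) (η : ℝ)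
    (u : H) : Integrable (fun p => gradStep η u p) ρ :=
  (integrable_const u).sub ((integrable_residual_smul ρ hy hx u).smul η)

theorem integral_gradStep (hy : ∀ᵐ p ∂ρ, |p.2| ≤ M) (hx : ∀ᵐ x ∂ρ.fst, ‖x‖ ^ 2 ≤ κ) (η : ℝ)
    (u : H) : ∫ p, gradStep η u p ∂ρ = riskStep ρ η u := by
  have h : ∫ p, η • ((⟪u, p.1⟫ - p.2) • p.1) ∂ρ = η • riskGrad ρ u := integral_smul _ _
  refine (integral_sub (integrable_const u)
    ((integrable_residual_smul ρ hy hx u).smul η)).trans ?_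
  simp only [Pi.smul_apply, h, riskStep]
  simp

/-- The step for the risk is the mean of the sample steps, which are almost surely nonexpansive. -/
theorem norm_riskStep_sub_le (hy : ∀ᵐ p ∂ρ, |p.2| ≤ M) (hx : ∀ᵐ x ∂ρ.fst, ‖x‖ ^ 2 ≤ κ) {η : ℝ}
    (hη : 0 ≤ η) (hηκ : η * κ ≤ 1) (u v : H) :
    ‖riskStep ρ η u - riskStep ρ η v‖ ≤ ‖u - v‖ := by
  rw [← integral_gradStep ρ hy hx, ← integral_gradStep ρ hy hx,
    ← integral_sub (integrable_gradStep ρ hy hx η u) (integrable_gradStep ρ hy hx η v)]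
  refine (norm_integral_le_of_norm_le_const (C := ‖u - v‖) ?_).trans (by simp)
  filter_upwards [ae_fst ρ hx] with p hp using norm_gradStep_sub_le hη hηκ hp u v

theorem ae_norm_gradStep_sub_riskStep_le (hy : ∀ᵐ p ∂ρ, |p.2| ≤ M)
    (hx : ∀ᵐ x ∂ρ.fst, ‖x‖ ^ 2 ≤ κ) {η : ℝ} (hη : 0 ≤ η) (u : H) :
    ∀ᵐ p ∂ρ, ‖gradStep η u p - riskStep ρ η u‖ ≤ η * (2 * ((√κ * ‖u‖ + M) * √κ)) := by
  have hb : ∀ᵐ p ∂ρ, ‖(⟪u, p.1⟫ - p.2) • p.1‖ ≤ (√κ * ‖u‖ + M) * √κ := by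
    filter_upwards [hy, ae_fst ρ hx] with p h1 h2 using norm_residual_smul_le h2 h1
  have hg : ‖riskGrad ρ u‖ ≤ (√κ * ‖u‖ + M) * √κ :=
    (norm_integral_le_of_norm_le_const hb).trans (by simp)
  filter_upwards [hb] with p hp
  have : gradStep η u p - riskStep ρ η u = η • (riskGrad ρ u - (⟪u, p.1⟫ - p.2) • p.1) := by
    simp only [gradStep, riskStep]; module
  rw [this, norm_smul, Real.norm_of_nonneg hη]
  gcongr
  exact (norm_sub_le _ _).trans (by linarith)

/-- An exponential moment bound for the distance between one pass over independent samples and the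
corresponding gradient steps for the risk. -/
theorem lintegral_cosh_gradPass_sub_le (hy : ∀ᵐ p ∂ρ, |p.2| ≤ M)
    (hx : ∀ᵐ x ∂ρ.fst, ‖x‖ ^ 2 ≤ κ) {η : ℝ} (hη : 0 ≤ η) (hηκ : η * κ ≤ 1) {v : H}
    (hv : riskGrad ρ v = 0) {B c : ℝ}
    (hc : η * (2 * ((√κ * (B + ‖v‖) + M) * √κ)) ≤ c) (l : ℝ) (m : ℕ) (u : H)
    (hu : ‖u - v‖ ≤ B) :
    ∫⁻ z, ENNReal.ofReal (Real.cosh ‖l • (gradPass η z u - (riskStep ρ η)^[m] u)‖)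
      ∂(Measure.pi fun _ : Fin m => ρ) ≤ ENNReal.ofReal (Real.cosh (l * c) ^ m) := by
  have : SecondCountableTopology H := UniformSpace.secondCountable_of_separable H
  induction m generalizing u with
  | zero => simp [gradPass]
  | succ m ih =>
    have hmeas : ∀ (k : ℕ) (w : H), Measurable fun z : Fin k → H × ℝ =>
        ENNReal.ofReal (Real.cosh ‖l • (gradPass η z u - w)‖) := fun k w =>
      (Real.continuous_cosh.measurable.comp ((((measurable_gradPass η k).comp
        (measurable_id.prodMk measurable_const)).sub_const w).const_smul l).norm).ennreal_ofReal
    set G := riskStep ρ η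
    have hmp := measurePreserving_piFinSuccAbove (fun _ : Fin (m + 1) => ρ) 0
    -- The first sample is integrated innermost, with the later ones fixed: then `Q` is a fixed
    -- contraction acting on the centred noise `gradStep η u p - G u`.
    rw [← hmp.symm.lintegral_comp (hmeas _ _), lintegral_prod_symm]
    swap
    · exact ((hmeas _ _).comp hmp.symm.measurable).aemeasurable
    have hGu : ‖G u - v‖ ≤ B := by
      have h1 : G v = v := by simp [G, riskStep, hv]
      have h2 := norm_riskStep_sub_le ρ hy hx hη hηκ u v
      rw [show riskStep ρ η v = v from h1] at h2
      exact h2.trans hu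
    have hstep : ∀ᵐ p ∂ρ, ‖gradStep η u p - G u‖ ≤ c := by
      have hun : ‖u‖ ≤ B + ‖v‖ := by
        have := norm_add_le (u - v) v
        rw [sub_add_cancel] at this
        linarith
      filter_upwards [ae_norm_gradStep_sub_riskStep_le ρ hy hx hη u] with p hp
      refine hp.trans (le_trans ?_ hc)
      gcongr
    have hz : ∀ᵐ z ∂(Measure.pi fun _ : Fin m => ρ), ∀ i, ‖(z i).1‖ ^ 2 ≤ κ := by
      rw [ae_all_iff]
      exact fun i => (measurePreserving_eval (fun _ : Fin m => ρ) i).quasiMeasurePreserving.ae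
        (ae_fst ρ hx)
    have hinner : ∀ᵐ z ∂(Measure.pi fun _ : Fin m => ρ),
        ∫⁻ p, ENNReal.ofReal (Real.cosh
          ‖l • (gradPass η z (gradStep η u p) - G^[m] (G u))‖) ∂ρ
        ≤ ENNReal.ofReal (Real.cosh ‖l • (gradPass η z (G u) - G^[m] (G u))‖)
          * ENNReal.ofReal (Real.cosh (l * c)) := by
      filter_upwards [hz] with z hz
      obtain ⟨Q, hQ, hQz⟩ := exists_gradPass_sub_eq hη hηκ z hz
      have hi : Integrable (fun p => gradStep η u p - G u) ρ :=
        (integrable_gradStep ρ hy hx η u).sub (integrable_const _)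
      have h0 : ∫ p, (gradStep η u p - G u) ∂ρ = 0 := by
        rw [integral_sub (integrable_gradStep ρ hy hx η u) (integrable_const _),
          integral_gradStep ρ hy hx]
        simp [G]
      have h := lintegral_cosh_norm_add_le ρ (d := fun p => (l • Q) (gradStep η u p - G u))
        ((l • Q).integrable_comp hi)
        (by rw [ContinuousLinearMap.integral_comp_comm _ hi, h0, map_zero]) (c := |l| * c)
        (by
          filter_upwards [hstep] with p hp
          rw [smul_apply, norm_smul, Real.norm_eq_abs]
          gcongr
          exact (hQ _).trans hp)
        (l • (gradPass η z (G u) - G^[m] (G u)))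
      have hcosh : Real.cosh (|l| * c) = Real.cosh (l * c) := by
        rcases abs_choice l with h | h <;> rw [h]
        rw [neg_mul, Real.cosh_neg]
      rw [← ENNReal.ofReal_mul (Real.cosh_pos _).le, ← hcosh]
      refine le_trans (le_of_eq ?_) h
      refine lintegral_congr fun p => ?_
      congr 3
      rw [smul_apply, ← hQz]
      module
    have hcons : ∀ (p : H × ℝ) (z : Fin m → H × ℝ),
        gradPass η ((MeasurableEquiv.piFinSuccAbove (fun _ => H × ℝ) 0).symm (p, z)) u
          = gradPass η z (gradStep η u p) := fun p z => by
      rw [gradPass_succ]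
      simp [MeasurableEquiv.piFinSuccAbove, Fin.insertNthEquiv]
    simp only [hcons, Function.iterate_succ_apply]
    refine (lintegral_mono_ae hinner).trans ?_
    rw [lintegral_mul_const' _ _ ENNReal.ofReal_ne_top, pow_succ,
      ENNReal.ofReal_mul (pow_nonneg (Real.cosh_pos _).le _)]
    gcongr
    exact ih (G u) hGu

end Deviation

/-! ### High-probability bounds. -/

section Bounds

variable {H : Type*} [NormedAddCommGroup H] [InnerProductSpace ℝ H] [CompleteSpace H]
  [TopologicalSpace.SeparableSpace H] [MeasurableSpace H] [BorelSpace H]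
  (ρ : Measure (H × ℝ)) [IsProbabilityMeasure ρ] {M κ : ℝ}

/-- If the average of `cosh (l aₛ)` is small then so is the average of the `aₛ`. -/
theorem sum_le_of_sum_cosh_lt {t : ℕ} (ht : 0 < t) (a : ℕ → ℝ) {l L : ℝ} (hl : 0 < l)
    (h : ∑ s ∈ Finset.range t, Real.cosh (l * a s) < t * (Real.exp L / 2)) :
    ∑ s ∈ Finset.range t, a s ≤ t * (L / l) := by
  have ht' : (0 : ℝ) < t := by exact_mod_cast ht
  have hJ := convexOn_exp.map_sum_le (t := Finset.range t) (w := fun _ => (t : ℝ)⁻¹)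
    (p := fun s => l * a s) (fun _ _ => by positivity) (by simp [ht'.ne']) fun _ _ => trivial
  simp only [smul_eq_mul, ← Finset.mul_sum] at hJ
  have hle : ∑ s ∈ Finset.range t, Real.exp (l * a s)
      ≤ 2 * ∑ s ∈ Finset.range t, Real.cosh (l * a s) := by
    rw [Finset.mul_sum]
    refine Finset.sum_le_sum fun s _ => ?_
    rw [Real.cosh_eq]
    linarith [Real.exp_pos (-(l * a s))]
  have h1 : Real.exp ((t : ℝ)⁻¹ * (l * ∑ s ∈ Finset.range t, a s)) < Real.exp L := by
    refine hJ.trans_lt ?_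
    rw [inv_mul_lt_iff₀ ht']
    linarith
  have h2 := Real.exp_lt_exp.1 h1
  rw [inv_mul_lt_iff₀ ht'] at h2
  rw [← mul_div_assoc, le_div_iff₀ hl]
  linarith

/-- With high probability the errors of the passes started from `w₀, …, w_{t-1}` are small on
average. -/
theorem exists_measurableSet_sum_gradPass_sub_le (hy : ∀ᵐ p ∂ρ, |p.2| ≤ M)
    (hx : ∀ᵐ x ∂ρ.fst, ‖x‖ ^ 2 ≤ κ) {η : ℝ} (hη : 0 ≤ η) (hηκ : η * κ ≤ 1) {v : H}
    (hv : riskGrad ρ v = 0) {B c : ℝ} (hc0 : 0 < c)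
    (hc : η * (2 * ((√κ * (B + ‖v‖) + M) * √κ)) ≤ c) {n : ℕ} (hn : 0 < n) (w : ℕ → H)
    (hw : ∀ s, ‖w s - v‖ ≤ B) {t : ℕ} (ht : 0 < t) {δ : ℝ} (hδ : 0 < δ) :
    ∃ A : Set (Fin n → H × ℝ), MeasurableSet A ∧
      (Measure.pi fun _ : Fin n => ρ) A < ENNReal.ofReal δ ∧
      ∀ z ∉ A, ∑ s ∈ Finset.range t, ‖gradPass η z (w s) - (riskStep ρ η)^[n] (w s)‖
        ≤ t * (Real.log (16 / δ) * (√n * c)) := by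
  have : SecondCountableTopology H := UniformSpace.secondCountable_of_separable H
  have hn' : (0 : ℝ) < n := by exact_mod_cast hn
  have ht' : (0 : ℝ) < t := by exact_mod_cast ht
  -- With this `l`, `cosh (l c) ^ n ≤ exp (n (l c)² / 2) = exp (1 / 2)`.
  set l : ℝ := (√n * c)⁻¹
  have hl : 0 < l := by positivity
  set D : ℕ → (Fin n → H × ℝ) → ℝ :=
    fun s z => ‖gradPass η z (w s) - (riskStep ρ η)^[n] (w s)‖
  set Y : (Fin n → H × ℝ) → ℝ≥0∞ :=
    fun z => ∑ s ∈ Finset.range t, ENNReal.ofReal (Real.cosh (l * D s z))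
  have hD : ∀ s, Measurable (D s) := fun s =>
    (((measurable_gradPass η n).comp (measurable_id.prodMk measurable_const)).sub_const _).norm
  have hDc : ∀ s, Measurable fun z => ENNReal.ofReal (Real.cosh (l * D s z)) := fun s =>
    (Real.continuous_cosh.measurable.comp ((hD s).const_mul l)).ennreal_ofReal
  have hY : Measurable Y := Finset.measurable_fun_sum _ fun s _ => hDc s
  have hYi : ∫⁻ z, Y z ∂(Measure.pi fun _ : Fin n => ρ) ≤ ENNReal.ofReal (t * Real.exp (1 / 2)) := by
    rw [lintegral_finsetSum _ fun s _ => hDc s]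
    calc _ ≤ ∑ s ∈ Finset.range t, ENNReal.ofReal (Real.exp (1 / 2)) := by
          refine Finset.sum_le_sum fun s _ => ?_
          have h := lintegral_cosh_gradPass_sub_le ρ hy hx hη hηκ hv hc l n (w s) (hw s)
          simp only [norm_smul, Real.norm_of_nonneg hl.le] at h
          refine h.trans (ENNReal.ofReal_le_ofReal ?_)
          calc Real.cosh (l * c) ^ n ≤ Real.exp ((l * c) ^ 2 / 2) ^ n := by
                have := (Real.cosh_pos (l * c)).le
                gcongr
                exact Real.cosh_le_exp_half_sq _
            _ = _ := by
                rw [← Real.exp_nat_mul]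
                congr 1
                have hs : √(n : ℝ) ^ 2 = n := Real.sq_sqrt hn'.le
                have : l * c = (√n)⁻¹ := by simp only [l]; field_simp
                rw [this, inv_pow, hs]
                field_simp
      _ = _ := by
          rw [Finset.sum_const, Finset.card_range, nsmul_eq_mul,
            ENNReal.ofReal_mul ht'.le, ENNReal.ofReal_natCast]
  -- The threshold is `8 t / δ`, so Markov's inequality gives probability at most `δ exp (1 / 2) / 8
  -- < δ`.
  refine ⟨{z | ENNReal.ofReal (t * (Real.exp (Real.log (16 / δ)) / 2)) ≤ Y z},
    measurableSet_le measurable_const hY, ?_, fun z hz => ?_⟩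
  · rw [Real.exp_log (by positivity)]
    have h := (mul_meas_ge_le_lintegral hY (ENNReal.ofReal (t * (16 / δ / 2)))).trans hYi
    have hpos : 0 < t * (16 / δ / 2) := by positivity
    rw [mul_comm, ← ENNReal.le_div_iff_mul_le (Or.inl (ENNReal.ofReal_pos.2 hpos).ne')
      (Or.inl ENNReal.ofReal_ne_top), ← ENNReal.ofReal_div_of_pos hpos] at h
    refine h.trans_lt ((ENNReal.ofReal_lt_ofReal_iff hδ).2 ?_)
    rw [div_lt_iff₀ hpos]
    have he : Real.exp (1 / 2) < 8 := by
      refine (Real.exp_lt_exp.2 (by norm_num : (1 / 2 : ℝ) < 1)).trans ?_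
      linarith [Real.exp_one_lt_d9]
    calc t * Real.exp (1 / 2) < t * 8 := by gcongr
      _ = _ := by field_simp; norm_num
  · have hlt : Y z < ENNReal.ofReal (t * (Real.exp (Real.log (16 / δ)) / 2)) := not_le.1 hz
    have hYz : Y z = ENNReal.ofReal (∑ s ∈ Finset.range t, Real.cosh (l * D s z)) :=
      (ENNReal.ofReal_sum_of_nonneg fun s _ => (Real.cosh_pos _).le).symm
    rw [hYz, ENNReal.ofReal_lt_ofReal_iff (by positivity)] at hlt
    have h := sum_le_of_sum_cosh_lt ht (fun s => D s z) hl hlt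
    simpa only [l, div_inv_eq_mul] using h

/-- The step on `H` contracts `u - v` by `1 - η S* S`, and `S (1 - η S* S) = (1 - η S S*) S` moves
the iteration to `L²`. -/
theorem iterate_riskStep_sub (hy : ∀ᵐ p ∂ρ, |p.2| ≤ M) (hx : ∀ᵐ x ∂ρ.fst, ‖x‖ ^ 2 ≤ κ) (η : ℝ)
    {v : H} (hv : riskGrad ρ v = 0) (m : ℕ) (u : H) :
    evalOp ρ.fst hx ((riskStep ρ η)^[m] u - v)
      = ((ContinuousLinearMap.id ℝ (Lp ℝ 2 ρ.fst) -
          η • (evalOp ρ.fst hx ∘L (evalOp ρ.fst hx).adjoint)) ^ m) (evalOp ρ.fst hx (u - v)) := by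
  induction m generalizing u with
  | zero => simp
  | succ m ih =>
    rw [Function.iterate_succ_apply, ih, pow_succ, mul_apply_eq_comp]
    congr 1
    have h := riskGrad_sub ρ hy hx u v
    rw [hv, sub_zero] at h
    rw [riskStep, h]
    simp only [map_sub, map_smul, sub_apply, smul_apply, ContinuousLinearMap.id_apply,
      ContinuousLinearMap.comp_apply]
    module

/-- The bound on the excess risk with explicit deviation and approximation terms. -/
theorem lt_measureReal_excess_risk_le (hM : 0 < M) (hκ : 0 < κ) (hy : ∀ᵐ p ∂ρ, |p.2| ≤ M)
    (hx : ∀ᵐ x ∂ρ.fst, ‖x‖ ^ 2 ≤ κ) {r : ℝ} (hr : 1 / 2 < r) {g gρ : Lp ℝ 2 ρ.fst}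
    (hgρ : IsBestApprox ρ gρ) (hg : gρ = fracPow (integralOp ρ.fst hx) r g)
    {γ : ℝ} (hγ : 0 < γ) (hγκ : γ ≤ κ⁻¹) {Ω : Type*} [MeasurableSpace Ω] (P : Measure Ω)
    [IsProbabilityMeasure P] {n : ℕ} (hn : 0 < n) {z : Fin n → Ω → H × ℝ}
    (hz : ∀ i, Measurable (z i)) (hlaw : ∀ i, P.map (z i) = ρ) (hind : iIndepFun z P)
    {δ : ℝ} (hδ0 : 0 < δ) {t : ℕ} (ht : 0 < t) :
    1 - δ < P.real {ω | risk ρ (iterates γ (fun i => z i ω) 0 t) - ⨅ w : H, risk ρ w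
      ≤ 2 * (2 * Real.log (16 / δ)) ^ 2 / n * (M + 2 * κ ^ r * ‖g‖) ^ 2 * (t : ℝ) ^ 2
        + 2 * (r / (γ * t)) ^ (2 * r) * ‖g‖ ^ 2} := by
  have hn' : (0 : ℝ) < n := by exact_mod_cast hn
  have hn1 : (1 : ℝ) ≤ n := by exact_mod_cast hn
  have ht' : (0 : ℝ) < t := by exact_mod_cast ht
  have hγκ1 : γ * κ ≤ 1 := by
    calc γ * κ ≤ κ⁻¹ * κ := by gcongr
      _ = 1 := inv_mul_cancel₀ hκ.ne'
  set η : ℝ := γ / n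
  have hη : 0 < η := by positivity
  have hηκ : η * κ ≤ 1 := by
    refine le_trans ?_ hγκ1
    gcongr
    exact div_le_self hγ.le hn1
  set S := evalOp ρ.fst hx
  have hS : ∀ w, ‖S w‖ ^ 2 ≤ κ * ‖w‖ ^ 2 := norm_evalOp_sq_le ρ.fst hκ.le hx
  rw [integralOp_eq] at hg
  obtain ⟨v, hSv, hvn⟩ := exists_preimage_fracPow hκ.le hS g hr
  have hSv' : S v = gρ := hSv.trans hg.symm
  have hv : riskGrad ρ v = 0 := riskGrad_eq_zero ρ hy hx hgρ hSv'
  set G := riskStep ρ η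
  set K := M + 2 * κ ^ r * ‖g‖
  have hK : 0 < K := by positivity
  have hw : ∀ m : ℕ, ‖G^[m] 0 - v‖ ≤ ‖v‖ := fun m => by
    induction m with
    | zero => simp
    | succ m ih =>
      rw [Function.iterate_succ_apply']
      have h1 : riskStep ρ η v = v := by simp [riskStep, hv]
      have h2 := norm_riskStep_sub_le ρ hy hx hη.le hηκ (G^[m] 0) v
      rw [h1] at h2
      exact h2.trans ih
  -- The reference orbit stays within `‖v‖` of `v`, hence has norm at most `2 ‖v‖`, and `√κ ‖v‖ ≤ κ
  -- ^ r ‖g‖`; this is the origin of `K`.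
  have hc : η * (2 * ((√κ * (‖v‖ + ‖v‖) + M) * √κ)) ≤ 2 * η * √κ * K := by
    have h1 : √κ * ‖v‖ ≤ κ ^ r * ‖g‖ := by
      calc √κ * ‖v‖ ≤ √κ * (κ ^ (r - 1 / 2) * ‖g‖) := by gcongr
        _ = κ ^ r * ‖g‖ := by
          rw [Real.sqrt_eq_rpow, ← mul_assoc, ← Real.rpow_add hκ]
          congr 2; ring
    calc _ = 2 * η * √κ * (M + 2 * (√κ * ‖v‖)) := by ring
      _ ≤ 2 * η * √κ * (M + 2 * (κ ^ r * ‖g‖)) := by gcongr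
      _ = _ := by simp only [K]; ring
  obtain ⟨A, hA, hPA, hAz⟩ := exists_measurableSet_sum_gradPass_sub_le ρ hy hx hη.le hηκ hv
    (by positivity) hc hn (fun s => (G^[n])^[s] 0)
    (fun s => by rw [← Function.iterate_mul]; exact hw _) ht hδ0
  have hmeas : Measurable fun ω i => z i ω := measurable_pi_iff.2 hz
  have hmap : P.map (fun ω i => z i ω) = Measure.pi fun _ => ρ := by
    rw [(iIndepFun_iff_map_fun_eq_pi_map fun i => (hz i).aemeasurable).1 hind]
    simp only [hlaw]
  have hbound : ∀ᵐ ω ∂P, ∀ i, ‖(z i ω).1‖ ^ 2 ≤ κ := by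
    rw [ae_all_iff]
    intro i
    refine ae_of_ae_map (hz i).aemeasurable (p := fun p => ‖p.1‖ ^ 2 ≤ κ) ?_
    rw [hlaw i]
    exact ae_fst ρ hx
  have hmain : ∀ᵐ ω ∂P, ω ∈ ((fun ω i => z i ω) ⁻¹' A)ᶜ →
      ω ∈ {ω | risk ρ (iterates γ (fun i => z i ω) 0 t) - ⨅ w : H, risk ρ w
        ≤ 2 * (2 * Real.log (16 / δ)) ^ 2 / n * K ^ 2 * (t : ℝ) ^ 2
          + 2 * (r / (γ * t)) ^ (2 * r) * ‖g‖ ^ 2} := by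
    filter_upwards [hbound] with ω hω hωA
    have hsum := hAz _ hωA
    set zω : Fin n → H × ℝ := fun i => z i ω
    set u := iterates γ zω 0 t
    set wt := (G^[n])^[t] 0
    have h1 : ‖u - wt‖ ≤ t * (Real.log (16 / δ) * (√n * (2 * η * √κ * K))) :=
      (norm_iterate_gradPass_sub_le hη.le hηκ zω hω (G^[n]) 0 t).trans hsum
    have h2 : ‖S (wt - v)‖ ≤ (r / (γ * t)) ^ r * ‖g‖ := by
      have h3 := iterate_riskStep_sub ρ hy hx η hv (n * t) 0
      rw [Function.iterate_mul] at h3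
      have h4 := norm_gradient_residual_fracPow_le hκ.le hS g (by linarith : 0 < r) hη hηκ
        (Nat.mul_pos hn ht)
      rw [← hSv] at h4
      have h5 : η * ((n * t : ℕ) : ℝ) = γ * t := by
        simp only [η]; push_cast; field_simp
      rw [h5] at h4
      rw [h3, zero_sub, map_neg, map_neg, norm_neg]
      exact h4
    have hrisk : risk ρ u - ⨅ w : H, risk ρ w = ‖S (u - wt) + S (wt - v)‖ ^ 2 := by
      rw [iInf_risk ρ hy hx hv, risk_eq ρ hy hx u v, hv, ← map_add, sub_add_sub_cancel]
      simp [S]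
    have h6 : ‖S (u - wt)‖ ^ 2
        ≤ (2 * Real.log (16 / δ)) ^ 2 / n * K ^ 2 * (t : ℝ) ^ 2 := by
      calc ‖S (u - wt)‖ ^ 2 ≤ κ * ‖u - wt‖ ^ 2 := hS _
        _ ≤ κ * (t * (Real.log (16 / δ) * (√n * (2 * η * √κ * K)))) ^ 2 := by gcongr
        -- The `√n` of the deviation against the step `γ / n` leaves `1 / n` after squaring.
        _ = (γ * κ) ^ 2 * ((2 * Real.log (16 / δ)) ^ 2 / n * K ^ 2 * (t : ℝ) ^ 2) := by
          have e1 : √(n : ℝ) ^ 2 = n := Real.sq_sqrt hn'.le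
          have e2 : √κ ^ 2 = κ := Real.sq_sqrt hκ.le
          simp only [mul_pow, e1, e2, η, div_pow]
          field_simp
        _ ≤ 1 * ((2 * Real.log (16 / δ)) ^ 2 / n * K ^ 2 * (t : ℝ) ^ 2) := by
          gcongr
          exact pow_le_one₀ (by positivity) hγκ1
        _ = _ := one_mul _
    have h7 : ‖S (wt - v)‖ ^ 2 ≤ (r / (γ * t)) ^ (2 * r) * ‖g‖ ^ 2 := by
      calc ‖S (wt - v)‖ ^ 2 ≤ ((r / (γ * t)) ^ r * ‖g‖) ^ 2 := by gcongr
        _ = _ := by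
          rw [mul_pow, ← Real.rpow_natCast, ← Real.rpow_mul (by positivity)]
          congr 2
          push_cast; ring
    change risk ρ u - ⨅ w : H, risk ρ w ≤ _
    rw [hrisk]
    have h8 : ‖S (u - wt) + S (wt - v)‖ ^ 2
        ≤ 2 * (‖S (u - wt)‖ ^ 2 + ‖S (wt - v)‖ ^ 2) :=
      (pow_le_pow_left₀ (norm_nonneg _) (norm_add_le _ _) 2).trans add_sq_le
    calc _ ≤ _ := h8
      _ ≤ 2 * ((2 * Real.log (16 / δ)) ^ 2 / n * K ^ 2 * (t : ℝ) ^ 2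
          + (r / (γ * t)) ^ (2 * r) * ‖g‖ ^ 2) := by gcongr
      _ = _ := by ring
  have hpre : P.real ((fun ω i => z i ω) ⁻¹' A) < δ := by
    rw [measureReal_def, ← Measure.map_apply hmeas hA, hmap]
    exact ENNReal.toReal_lt_of_lt_ofReal hPA
  calc 1 - δ < 1 - P.real ((fun ω i => z i ω) ⁻¹' A) := by linarith
    _ = P.real ((fun ω i => z i ω) ⁻¹' A)ᶜ := (probReal_compl_eq_one_sub (hmeas hA)).symm
    _ ≤ _ := ENNReal.toReal_mono (measure_ne_top _ _) (measure_mono_ae hmain)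

end Bounds

end IncrementalLearning

/-! ### The stated constants and the stopping time. -/

theorem theorem3 {H : Type*} [NormedAddCommGroup H] [InnerProductSpace ℝ H] [CompleteSpace H]
    [TopologicalSpace.SeparableSpace H] [MeasurableSpace H] [BorelSpace H]
    -- the law `ρ` of the pair `(X, Y)`, with `|y| ≤ M` and `‖x‖² ≤ κ` almost surely
    (ρ : Measure (H × ℝ)) [IsProbabilityMeasure ρ]
    (M κ : ℝ) (hM : 0 < M) (hκ : 0 < κ)
    (hy : ∀ᵐ p ∂ρ, |p.2| ≤ M) (hx : ∀ᵐ x ∂ρ.fst, ‖x‖ ^ 2 ≤ κ)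
    -- the source condition `g_ρ = L ^ r g`
    (r : ℝ) (hr : 1 / 2 < r) (g gρ : Lp ℝ 2 ρ.fst)
    (hgρ : IncrementalLearning.IsBestApprox ρ gρ)
    (hg : gρ = IncrementalLearning.fracPow (IncrementalLearning.integralOp ρ.fst hx) r g)
    -- the step size
    (γ : ℝ) (hγ : 0 < γ) (hγκ : γ ≤ κ⁻¹)
    -- the training set: `n` independent copies of `(X, Y)`
    {Ω : Type*} [MeasurableSpace Ω] (P : Measure Ω) [IsProbabilityMeasure P]
    (n : ℕ) (hn : 0 < n) (z : Fin n → Ω → H × ℝ) (hz : ∀ i, Measurable (z i))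
    (hlaw : ∀ i, P.map (z i) = ρ) (hind : iIndepFun z P)
    (δ : ℝ) (hδ0 : 0 < δ) (hδ1 : δ < 1) :
    (∀ t : ℕ, 0 < t →
      1 - δ < P.real {ω |
        IncrementalLearning.risk ρ (IncrementalLearning.iterates γ (fun i => z i ω) 0 t)
            - ⨅ w : H, IncrementalLearning.risk ρ w
          ≤ 2 * (32 * Real.log (16 / δ)) ^ 2 / n
              * (M + 2 * M ^ 2 * κ ^ (-(1 / 2) : ℝ) + 3 * κ ^ r * ‖g‖) ^ 2 * (t : ℝ) ^ 2
            + 2 * (r / (γ * t)) ^ (2 * r) * ‖g‖ ^ 2}) ∧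
    1 - δ < P.real {ω |
      IncrementalLearning.risk ρ (IncrementalLearning.iterates γ (fun i => z i ω) 0
            ⌈(n : ℝ) ^ (1 / (2 * (1 + r)))⌉₊)
          - ⨅ w : H, IncrementalLearning.risk ρ w
        ≤ (8 * (32 * Real.log (16 / δ)) ^ 2
              * (M + 2 * M ^ 2 * κ ^ (-(1 / 2) : ℝ) + 3 * κ ^ r * ‖g‖) ^ 2
            + 2 * (r / γ) ^ (2 * r) * ‖g‖ ^ 2) * (n : ℝ) ^ (-r / (r + 1))} := by
  have hn' : (0 : ℝ) < n := by exact_mod_cast hn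
  have hr0 : 0 < r := by linarith
  have hlog : 0 < Real.log (16 / δ) :=
    Real.log_pos (by rw [lt_div_iff₀ hδ0]; linarith)
  have hi : ∀ t : ℕ, 0 < t →
      1 - δ < P.real {ω |
        IncrementalLearning.risk ρ (IncrementalLearning.iterates γ (fun i => z i ω) 0 t)
            - ⨅ w : H, IncrementalLearning.risk ρ w
          ≤ 2 * (32 * Real.log (16 / δ)) ^ 2 / n
              * (M + 2 * M ^ 2 * κ ^ (-(1 / 2) : ℝ) + 3 * κ ^ r * ‖g‖) ^ 2 * (t : ℝ) ^ 2
            + 2 * (r / (γ * t)) ^ (2 * r) * ‖g‖ ^ 2} := fun t ht => by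
    refine (IncrementalLearning.lt_measureReal_excess_risk_le ρ hM hκ hy hx hr hgρ hg hγ hγκ P hn
      hz hlaw hind hδ0 ht).trans_le (measureReal_mono (Set.ofPred_subset_ofPred.2 fun ω hω =>
      le_trans hω ?_))
    have h1 : M + 2 * κ ^ r * ‖g‖
        ≤ M + 2 * M ^ 2 * κ ^ (-(1 / 2) : ℝ) + 3 * κ ^ r * ‖g‖ := by
      have h2 : 0 ≤ 2 * M ^ 2 * κ ^ (-(1 / 2) : ℝ) := by positivity
      have h3 : 0 ≤ κ ^ r * ‖g‖ := by positivity
      linarith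
    gcongr
    norm_num
  refine ⟨hi, ?_⟩
  set a : ℝ := (n : ℝ) ^ (1 / (2 * (1 + r)))
  have ha1 : 1 ≤ a := Real.one_le_rpow (by exact_mod_cast hn) (by positivity)
  have ha0 : 0 < a := by linarith
  have hlow : a ≤ (⌈a⌉₊ : ℝ) := Nat.le_ceil a
  -- Rounding up at most doubles `a ≥ 1`, which turns the constant `2` of the deviation term into
  -- `8`.
  have hup : (⌈a⌉₊ : ℝ) ≤ 2 * a := by linarith [Nat.ceil_lt_add_one ha0.le]
  -- The choice of `a` balances the two terms: `a ^ 2 / n` and `a ^ (-2 r)` are the same power of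
  -- `n`.
  have hsq : a ^ 2 / n = (n : ℝ) ^ (-r / (r + 1)) := by
    rw [← Real.rpow_natCast, ← Real.rpow_mul hn'.le, ← Real.rpow_sub_one hn'.ne']
    congr 1
    push_cast
    field_simp
    ring
  have hinv : (a⁻¹) ^ (2 * r) = (n : ℝ) ^ (-r / (r + 1)) := by
    rw [← Real.rpow_neg hn'.le, ← Real.rpow_mul hn'.le]
    congr 1
    field_simp
    ring
  refine (hi _ (Nat.ceil_pos.2 ha0)).trans_le (measureReal_mono (Set.ofPred_subset_ofPred.2 fun ω hω =>
      le_trans hω ?_))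
  set C := (M + 2 * M ^ 2 * κ ^ (-(1 / 2) : ℝ) + 3 * κ ^ r * ‖g‖) ^ 2
  have hC : 0 ≤ C := sq_nonneg _
  rw [add_mul]
  refine add_le_add ?_ ?_
  · calc 2 * (32 * Real.log (16 / δ)) ^ 2 / n * C * (⌈a⌉₊ : ℝ) ^ 2
        ≤ 2 * (32 * Real.log (16 / δ)) ^ 2 / n * C * (2 * a) ^ 2 := by gcongr
      _ = 8 * (32 * Real.log (16 / δ)) ^ 2 * C * (a ^ 2 / n) := by ring
      _ = _ := by rw [hsq]
  · calc 2 * (r / (γ * ⌈a⌉₊)) ^ (2 * r) * ‖g‖ ^ 2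
        ≤ 2 * (r / (γ * a)) ^ (2 * r) * ‖g‖ ^ 2 := by gcongr
      _ = 2 * (r / γ) ^ (2 * r) * ‖g‖ ^ 2 * (a⁻¹) ^ (2 * r) := by
          rw [← div_div, div_eq_mul_inv (r / γ), Real.mul_rpow (by positivity) (by positivity)]
          ring
      _ = _ := by rw [hinv]
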